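/- Let $0\le p\le n$ and let $\mathrm{Gr}_{n,p}=\{P\in\mathbb R^{n\times n}: P^T=P,\ P^2=P,\ \operatorname{rank}P=p\}$, with tangent spaces $T_P=\{\Delta:\Delta^T=\Delta,\ P\Delta+\Delta P=\Delta\}$ and the canonical Riemannian metric $\langle v,w\rangle_P=\tfrac12\operatorname{tr}(v^Tw)$. Let $\operatorname{Exp}$, $\operatorname{Log}$ and $\mathcal T$ be the Riemannian exponential map, the Riemannian logarithm (the initial velocity of a minimizing geodesic) and parallel transport along minimizing geodesics. Put $I=I_{n,p}=\begin{bmatrix}I_p&0\\0&0\end{bmatrix}$ and let $\mathcal C$ be the cut locus of $I$. For $P\notin\mathcal C$ and $Q\in\mathrm{Gr}_{n,p}$ put $P\oplus Q=\operatorname{Exp}_P\big(\mathcal T_{I\to P}(\operatorname{Log}_I Q)\big)$, which does not depend on the choice of $\operatorname{Log}_I Q$ when $Q\in\mathcal C$. Let $\ominus P$ be the left inverse of $P$, so that $\ominus P\oplus P=I$. Let $\|R\|=\sqrt{\langle\operatorname{Log}_I R,\operatorname{Log}_I R\rangle_I}$, the length of a minimizing geodesic from $I$ to $R$, and let $d(P,Q)=\|\ominus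 P\oplus Q\|$ be the Grassmann gyrodistance. For $A\notin\mathcal C$ let $\psi_A(Q)=A\oplus Q$ be the left gyrotranslation by $A$. Theorem. Left gyrotranslations preserve the Grassmann gyrodistance: for all $A,P,Q\in\mathrm{Gr}_{n,p}$ such that $A$, $P$ and $A\oplus P$ are not in $\mathcal C$, $$d(\psi_A(P),\psi_A(Q))=d(P,Q),$$ and moreover $\ominus\psi_A(P)\oplus\psi_A(Q)\in\mathcal C$ if and only if $\ominus P\oplus Q\in\mathcal C$. -/

import Mathlib

open scoped Matrix

namespace GrassmannGyro

/-- The Grassmann manifold of `p`-dimensional subspaces of `ℝⁿ` from the projector perspective: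
symmetric idempotent matrices of rank `p`. -/
def Gr (n p : ℕ) : Type :=
  {P : Matrix (Fin n) (Fin n) ℝ // Pᵀ = P ∧ P * P = P ∧ P.rank = p}

noncomputable section

/-- The identity element `I_{n,p}`, the block matrix with upper left block the identity of size `p`
and zeros elsewhere. -/
def idPoint {n p : ℕ} (hp : p ≤ n) : Gr n p :=
  ⟨Matrix.diagonal (fun i : Fin n => if (i : ℕ) < p then (1 : ℝ) else 0), by
    refine ⟨Matrix.diagonal_transpose _, ?_, ?_⟩
    · rw [Matrix.diagonal_mul_diagonal]
      congr 1
      funext i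
      split_ifs <;> simp
    · rw [Matrix.rank_diagonal]
      have e : {i : Fin n // (if (i : ℕ) < p then (1 : ℝ) else 0) ≠ 0} ≃ Fin p :=
        { toFun := fun i => ⟨i.1, by
            have h := i.2
            by_contra hlt
            simp [hlt] at h⟩
          invFun := fun j => ⟨⟨j.1, lt_of_lt_of_le j.2 hp⟩, by simp [j.2]⟩
          left_inv := fun i => rfl
          right_inv := fun j => rfl }
      rw [Fintype.card_congr e, Fintype.card_fin]⟩

/-- The tangent space of the Grassmannian at `P`: symmetric `Δ` with `P Δ + Δ P = Δ`. -/
def tangentSpace {n p : ℕ} (P : Gr n p) : Submodule ℝ (Matrix (Fin n) (Fin n) ℝ) where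
  carrier := {Δ | Δᵀ = Δ ∧ P.1 * Δ + Δ * P.1 = Δ}
  zero_mem' := by simp
  add_mem' := by
    rintro a b ⟨ha, ha'⟩ ⟨hb, hb'⟩
    refine ⟨by rw [Matrix.transpose_add, ha, hb], ?_⟩
    calc P.1 * (a + b) + (a + b) * P.1
        = (P.1 * a + a * P.1) + (P.1 * b + b * P.1) := by noncomm_ring
      _ = a + b := by rw [ha', hb']
  smul_mem' := by
    rintro c a ⟨ha, ha'⟩
    refine ⟨by rw [Matrix.transpose_smul, ha], ?_⟩
    rw [Matrix.mul_smul, Matrix.smul_mul, ← smul_add, ha']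

/-- The canonical metric, `⟨v, w⟩ = tr(vᵀ w) / 2`: in the projector perspective it is the
restriction to each tangent space of one fixed inner product on matrices. -/
def metric {n : ℕ} (v w : Matrix (Fin n) (Fin n) ℝ) : ℝ :=
  (1 / 2 : ℝ) * (vᵀ * w).trace

/-- A matrix orthogonal to the tangent space at `P`. -/
def IsNormal {n p : ℕ} (P : Gr n p) (x : Matrix (Fin n) (Fin n) ℝ) : Prop :=
  ∀ w ∈ tangentSpace P, metric x w = 0

/-- `γ : ℝ → Gr n p` is a geodesic: its covariant acceleration vanishes. The metric is induced from
an inner product on the ambient space, so the Levi-Civita covariant derivative is the tangential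
part of the ordinary derivative. -/
def IsGeodesic {n p : ℕ} (γ : ℝ → Gr n p) : Prop :=
  ∃ γ' γ'' : ℝ → Matrix (Fin n) (Fin n) ℝ, ∀ t : ℝ,
    HasDerivAt (fun s => (γ s).1) (γ' t) t ∧ HasDerivAt γ' (γ'' t) t ∧ IsNormal (γ t) (γ'' t)

/-- `W` is a parallel tangent vector field along `γ`. -/
def IsParallelAlong {n p : ℕ} (γ : ℝ → Gr n p) (W : ℝ → Matrix (Fin n) (Fin n) ℝ) : Prop :=
  (∀ t, W t ∈ tangentSpace (γ t)) ∧
  ∃ W' : ℝ → Matrix (Fin n) (Fin n) ℝ, ∀ t, HasDerivAt W (W' t) t ∧ IsNormal (γ t) (W' t)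

open Classical in
/-- The Riemannian exponential map `Exp_P(v)`: the value at time `1` of the geodesic
with `γ 0 = P` and `γ' 0 = v` (the value is `P` if `v` is not a tangent vector at `P`). -/
def expMap {n p : ℕ} (P : Gr n p) (v : Matrix (Fin n) (Fin n) ℝ) : Gr n p :=
  if h : ∃ γ : ℝ → Gr n p, IsGeodesic γ ∧ γ 0 = P ∧ HasDerivAt (fun s => (γ s).1) v 0
  then h.choose 1 else P

/-- The geodesic segment `t ↦ Exp_P(t v)`, `0 ≤ t ≤ 1`, is minimizing: no geodesic
segment from `P` to its endpoint is shorter. -/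
def IsMinimizing {n p : ℕ} (P : Gr n p) (v : Matrix (Fin n) (Fin n) ℝ) : Prop :=
  v ∈ tangentSpace P ∧
  ∀ w ∈ tangentSpace P, expMap P w = expMap P v → metric v v ≤ metric w w

/-- The cut locus of `P`: the endpoints of minimizing geodesic segments from `P` that are not
minimizing beyond their endpoint. -/
def cutLocus {n p : ℕ} (P : Gr n p) : Set (Gr n p) :=
  {Q | ∃ v, IsMinimizing P v ∧ expMap P v = Q ∧ ∀ s : ℝ, 1 < s → ¬ IsMinimizing P (s • v)}

open Classical in
/-- The Riemannian logarithm `Log_P(Q)`: the initial velocity of the minimizing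
geodesic from `P` to `Q`. It is unique for `Q` outside the cut locus of `P`; for `Q` in the cut locus
one of the minimizing velocities is chosen. -/
def logMap {n p : ℕ} (P Q : Gr n p) : Matrix (Fin n) (Fin n) ℝ :=
  if h : ∃ v, IsMinimizing P v ∧ expMap P v = Q then h.choose else 0

open Classical in
/-- Parallel transport of `w` from `P` to `Q` along the minimizing geodesic
`t ↦ Exp_P(t Log_P(Q))`. -/
def transport {n p : ℕ} (P Q : Gr n p) (w : Matrix (Fin n) (Fin n) ℝ) :
    Matrix (Fin n) (Fin n) ℝ :=
  if h : ∃ W, IsParallelAlong (fun t : ℝ => expMap P (t • logMap P Q)) W ∧ W 0 = w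
  then h.choose 1 else 0

/-- `P ⊕ Q = Exp_P(T_{I → P}(Log_I(Q)))` with `I = I_{n,p}`. It is defined for `P` outside the cut
locus of `I`; for `Q` in the cut locus of `I` the value does not depend on the chosen logarithm. -/
def gyroAdd {n p : ℕ} (hp : p ≤ n) (P Q : Gr n p) : Gr n p :=
  expMap P (transport (idPoint hp) P (logMap (idPoint hp) Q))

open Classical in
/-- The inverse `⊖ P`: the left inverse of `P`, that is `⊖ P ⊕ P = I_{n,p}`
(the value is `I_{n,p}` if there is no left inverse). -/
def gyroNeg {n p : ℕ} (hp : p ≤ n) (P : Gr n p) : Gr n p :=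
  if h : ∃ X : Gr n p, gyroAdd hp X P = idPoint hp then h.choose else idPoint hp

/-- The Grassmann inner product `⟨P, Q⟩ = ⟨Log_I(P), Log_I(Q)⟩_I`. -/
def gyroInner {n p : ℕ} (hp : p ≤ n) (P Q : Gr n p) : ℝ :=
  metric (logMap (idPoint hp) P) (logMap (idPoint hp) Q)

/-- The Grassmann norm induced by the Grassmann inner product. -/
def gyroNorm {n p : ℕ} (hp : p ≤ n) (P : Gr n p) : ℝ :=
  Real.sqrt (gyroInner hp P P)

/-- The Grassmann gyrodistance `d(P, Q) = ‖⊖ P ⊕ Q‖`. -/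
def gyroDist {n p : ℕ} (hp : p ≤ n) (P Q : Gr n p) : ℝ :=
  gyroNorm hp (gyroAdd hp (gyroNeg hp P) Q)

/-- The left Grassmann gyrotranslation `ψ_P(Q) = P ⊕ Q`. -/
def leftGyrotranslation {n p : ℕ} (hp : p ≤ n) (P : Gr n p) : Gr n p → Gr n p :=
  fun Q => gyroAdd hp P Q

end

end GrassmannGyro

/-!
# Left gyrotranslations of the Grassmannian are isometries of the gyrodistance

A geodesic `γ` of the Grassmannian has constant angular velocity `[γ', γ]`, because the normal
vectors at `γ t` are the symmetric matrices that commute with `γ t`. It follows that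
`Exp_P(v) = R P Rᵀ` for the rotation `R = exp [v, P]` (`expMap_coe`) and that parallel transport
along this geodesic is `w ↦ R w Rᵀ` (`transport_eq`). As the conjugation by an orthogonal matrix is
an isometry (`expMap_conj`), left gyrotranslation by `A` is the conjugation by the rotation
`exp [Log A, I]` (`gyroAdd_eq_conj`).

Thus `Q ↦ ⊖P ⊕ Q` and `Q ↦ ⊖(A ⊕ P) ⊕ (A ⊕ Q)` are isometries that both send `P` to `I`. They differ
by an isometry that fixes `I`, and such an isometry preserves the norm and the cut locus of `I`
(`cutLocus_and_gyroNorm_conj_eq`).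

Two facts about the exponential map stand behind this. Every point is the endpoint of a minimizing
geodesic (`exists_isMinimizing`), so that logarithms exist, and outside of the cut locus the
minimizing velocity is unique (`isMinimizing_unique`), so that `Exp_I(-Log P)` is a left inverse of
`P` (`exists_left_inverse`). Both rest on the functional calculus of symmetric matrices: in terms of
the reflection `S = 2 P - 1`, which anticommutes with the tangent vectors at `P`, the endpoint
`Exp_P(v)` has the reflection `cos (2 v) S + sin (2 v)` (`reflection_expMap`). A minimizing `v` has
spectrum in `[-π/2, π/2]`, and in the open interval if it extends beyond its endpoint; there
`cos (2 v)` and `sin (2 v)` determine `v`. Conversely `v` is constructed from a given endpoint as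
the arcsine of a matrix that is explicit except on the eigenspace where the principal angles are
`π/2`, on which a partial isometry between the two eigenspaces of `S` is needed.
-/

namespace GrassmannGyro

/-! ### Off-diagonal elements with respect to an idempotent -/

section OffDiagonal

variable {R : Type*} [Ring R] {e v w x d : R}

/-- An element `v` with `e * v + v * e = v` is off-diagonal in the block decomposition defined by
the idempotent `e`: its diagonal blocks vanish. -/
theorem mul_mul_eq_zero_of_offDiagonal (he : e * e = e) (hv : e * v + v * e = v) :
    e * v * e = 0 := by
  linear_combination (norm := noncomm_ring) e * hv - he * v

theorem commutator_offDiagonal (he : e * e = e) :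
    e * (v * e - e * v) + (v * e - e * v) * e = v * e - e * v := by
  linear_combination (norm := noncomm_ring) v * he - he * v

theorem commutator_commutator_of_offDiagonal (he : e * e = e) (hv : e * v + v * e = v) :
    (v * e - e * v) * e - e * (v * e - e * v) = v := by
  linear_combination (norm := noncomm_ring)
    v * he + he * v + hv - 2 * mul_mul_eq_zero_of_offDiagonal he hv

/-- The product of two off-diagonal elements is block diagonal. -/
theorem commute_mul_of_offDiagonal (hv : e * v + v * e = v) (hw : e * w + w * e = w) :
    e * (v * w) = v * w * e := by
  linear_combination (norm := noncomm_ring) hv * w - v * hw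

theorem commute_commutator_of_offDiagonal (hv : e * v + v * e = v) (hw : e * w + w * e = w) :
    e * (v * w - w * v) = (v * w - w * v) * e := by
  linear_combination (norm := noncomm_ring)
    commute_mul_of_offDiagonal hv hw - commute_mul_of_offDiagonal hw hv

theorem eq_zero_of_commute_of_offDiagonal (he : e * e = e) (h : e * d = d * e)
    (hd : e * d + d * e = d) : d = 0 := by
  linear_combination (norm := noncomm_ring) -hd - h + 2 * (e * hd + e * h - 2 * (he * d))

/-- If `w` stays off-diagonal while the idempotent `e` moves with velocity `[v, e]`, and the
derivative `x` of `w` commutes with `e`, then `x = [v, w]`. -/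
theorem eq_commutator_of_offDiagonal (he : e * e = e) (hv : e * v + v * e = v)
    (hw : e * w + w * e = w) (hx : e * x = x * e)
    (h : (v * e - e * v) * w + e * x + (x * e + w * (v * e - e * v)) = x) :
    x = v * w - w * v := by
  refine sub_eq_zero.1 (eq_zero_of_commute_of_offDiagonal he (d := x - (v * w - w * v)) ?_ ?_)
  · linear_combination (norm := noncomm_ring) hx - commute_commutator_of_offDiagonal hv hw
  · linear_combination (norm := noncomm_ring) h - v * hw + hw * v

/-- The off-diagonal part of `x`. -/
def offDiagonalPart (e x : R) : R := e * x + x * e - 2 * (e * x * e)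

theorem offDiagonalPart_offDiagonal (he : e * e = e) :
    e * offDiagonalPart e x + offDiagonalPart e x * e = offDiagonalPart e x := by
  unfold offDiagonalPart
  linear_combination (norm := noncomm_ring) he * x + x * he - 2 * (he * x * e) - 2 * (e * x * he)

theorem commute_sub_offDiagonalPart (he : e * e = e) :
    e * (x - offDiagonalPart e x) = (x - offDiagonalPart e x) * e := by
  unfold offDiagonalPart
  linear_combination (norm := noncomm_ring) -(he * x) + x * he + 2 * (he * x * e) - 2 * (e * x * he)

theorem commute_of_offDiagonalPart_eq_zero (he : e * e = e) (h : offDiagonalPart e x = 0) :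
    e * x = x * e := by
  unfold offDiagonalPart at h
  linear_combination (norm := noncomm_ring)
    e * h - h * e - he * x + 2 * (he * x * e) + x * he - 2 * (e * x * he)

end OffDiagonal

section Geodesics

open scoped Matrix.Norms.Operator
open NormedSpace (exp)

variable {n p : ℕ}

/-! ### One-parameter groups of conjugations -/

theorem exp_smul_mul_exp_smul_neg (Ω : Matrix (Fin n) (Fin n) ℝ) (t : ℝ) :
    exp (t • Ω) * exp (t • -Ω) = 1 := by
  rw [smul_neg, ← Matrix.exp_add_of_commute _ _ (Commute.refl (t • Ω)).neg_right, add_neg_cancel,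
    NormedSpace.exp_zero]

theorem exp_smul_neg_mul_exp_smul (Ω : Matrix (Fin n) (Fin n) ℝ) (t : ℝ) :
    exp (t • -Ω) * exp (t • Ω) = 1 := by
  simpa using exp_smul_mul_exp_smul_neg (-Ω) t

theorem hasDerivAt_conj_exp (Ω : Matrix (Fin n) (Fin n) ℝ) {f : ℝ → Matrix (Fin n) (Fin n) ℝ}
    {f' : Matrix (Fin n) (Fin n) ℝ} {t : ℝ} (hf : HasDerivAt f f' t) :
    HasDerivAt (fun s => exp (s • Ω) * f s * exp (s • -Ω))
      (exp (t • Ω) * (f' + (Ω * f t - f t * Ω)) * exp (t • -Ω)) t := by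
  have h1 := hasDerivAt_exp_smul_const (𝕂 := ℝ) Ω t
  have h2 := hasDerivAt_exp_smul_const' (𝕂 := ℝ) (-Ω) t
  refine ((h1.mul hf).mul h2).congr_deriv ?_
  change (exp (t • Ω) * Ω * f t + exp (t • Ω) * f') * exp (t • -Ω) +
    exp (t • Ω) * f t * (-Ω * exp (t • -Ω)) = _
  generalize exp (t • -Ω) = F
  noncomm_ring

/-- The Lax equation `f' = [Ω, f]` with constant `Ω` has only the solution `e^{tΩ} f(0) e^{-tΩ}`. -/
theorem eq_conj_exp_of_hasDerivAt (Ω : Matrix (Fin n) (Fin n) ℝ)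
    {f : ℝ → Matrix (Fin n) (Fin n) ℝ} (hf : ∀ t, HasDerivAt f (Ω * f t - f t * Ω) t) (t : ℝ) :
    f t = exp (t • Ω) * f 0 * exp (t • -Ω) := by
  have key : ∀ s, HasDerivAt (fun s => exp (s • -Ω) * f s * exp (s • - -Ω)) 0 s := fun s =>
    (hasDerivAt_conj_exp (-Ω) (hf s)).congr_deriv (by noncomm_ring)
  have hc := is_const_of_deriv_eq_zero (fun s => (key s).differentiableAt)
    (fun s => (key s).deriv) t 0
  simp only [neg_neg, zero_smul, NormedSpace.exp_zero, one_mul, mul_one] at hc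
  calc f t = (exp (t • Ω) * exp (t • -Ω)) * f t * (exp (t • Ω) * exp (t • -Ω)) := by
        rw [exp_smul_mul_exp_smul_neg, one_mul, mul_one]
    _ = exp (t • Ω) * (exp (t • -Ω) * f t * exp (t • Ω)) * exp (t • -Ω) := by
        simp only [mul_assoc]
    _ = _ := by rw [hc]

/-! ### Tangent and normal vectors -/

theorem trace_mul_eq_zero_of_commute {P x w : Matrix (Fin n) (Fin n) ℝ} (hP : P * P = P)
    (hx : P * x = x * P) (hw : P * w + w * P = w) : (x * w).trace = 0 := by
  have h0 : P * w * P = 0 := mul_mul_eq_zero_of_offDiagonal hP hw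
  have h1 : (x * (P * w)).trace = 0 := by
    calc (x * (P * w)).trace = (x * P * P * w).trace := by rw [mul_assoc x P P, hP, mul_assoc]
      _ = (P * (x * P * w)).trace := by rw [← mul_assoc P, ← mul_assoc P, hx]
      _ = (x * (P * w * P)).trace := by rw [Matrix.trace_mul_comm]; simp only [mul_assoc]
      _ = 0 := by rw [h0, mul_zero, Matrix.trace_zero]
  have h2 : (x * (w * P)).trace = 0 := by
    calc (x * (w * P)).trace = (x * (w * P) * P).trace := by simp only [mul_assoc, hP]
      _ = (x * (P * w * P)).trace := by
        rw [Matrix.trace_mul_comm, ← mul_assoc, hx]; simp only [mul_assoc]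
      _ = 0 := by rw [h0, mul_zero, Matrix.trace_zero]
  rw [← hw, mul_add, Matrix.trace_add, h1, h2, add_zero]

/-- The normal space at `P`, within the symmetric matrices, is the commutant of `P`. -/
theorem isNormal_iff_commute (P : Gr n p) {x : Matrix (Fin n) (Fin n) ℝ} (hx : xᵀ = x) :
    IsNormal P x ↔ P.1 * x = x * P.1 := by
  obtain ⟨P, hPt, hPP, hr⟩ := P
  simp only
  constructor
  · intro h
    -- the tangential part of `x` is orthogonal to `x` and to the normal part of `x`
    set w := offDiagonalPart P x with hwdef
    have hwt : wᵀ = w := by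
      simp only [hwdef, offDiagonalPart, two_mul, Matrix.transpose_sub, Matrix.transpose_add,
        Matrix.transpose_mul, hPt, hx, mul_assoc]
      abel
    have hwP : P * w + w * P = w := by
      exact offDiagonalPart_offDiagonal hPP
    have h1 : (x * w).trace = 0 := by
      have := h w ⟨hwt, hwP⟩
      simpa [metric, hx] using this
    have h2 : ((x - w) * w).trace = 0 :=
      trace_mul_eq_zero_of_commute hPP (commute_sub_offDiagonalPart hPP) hwP
    have h3 : (wᵀ * w).trace = 0 := by
      rw [sub_mul, Matrix.trace_sub, h1] at h2
      rw [hwt]; linarith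
    have h4 : w = 0 := by
      rwa [← Matrix.conjTranspose_eq_transpose_of_trivial,
        Matrix.trace_conjTranspose_mul_self_eq_zero_iff] at h3
    exact commute_of_offDiagonalPart_eq_zero hPP h4
  · rintro h w ⟨-, hw⟩
    simp [metric, hx, trace_mul_eq_zero_of_commute hPP h hw]

theorem transpose_eq_of_hasDerivAt {f : ℝ → Matrix (Fin n) (Fin n) ℝ}
    {f' : Matrix (Fin n) (Fin n) ℝ}
    {t : ℝ} (hf : HasDerivAt f f' t) (hs : ∀ s, (f s)ᵀ = f s) : f'ᵀ = f' := by
  have h : HasDerivAt (fun s => (f s)ᵀ) f'ᵀ t := by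
    exact hasDerivAt_pi.2 fun i => hasDerivAt_pi.2 fun j => hasDerivAt_pi.1 (hasDerivAt_pi.1 hf j) i
  simp only [hs] at h
  exact h.unique hf

theorem derivative_mem_tangentSpace {γ : ℝ → Gr n p} {v : Matrix (Fin n) (Fin n) ℝ} {t : ℝ}
    (h : HasDerivAt (fun s => (γ s).1) v t) : v ∈ tangentSpace (γ t) := by
  refine ⟨transpose_eq_of_hasDerivAt h fun s => (γ s).2.1, ?_⟩
  have h2 := h.mul h
  have h3 : (fun s => (γ s).1) * (fun s => (γ s).1) = fun s => (γ s).1 :=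
    funext fun s => (γ s).2.2.1
  rw [h3] at h2
  rw [add_comm]
  exact h2.unique h

/-! ### Geodesics, the exponential map and parallel transport in closed form -/

/-- A geodesic has constant angular velocity `[γ', γ]`, since the derivative of this commutator is
`[γ'', γ]` and normal vectors commute with the base point. -/
theorem IsGeodesic.eq_conj_exp {γ : ℝ → Gr n p} (hγ : IsGeodesic γ)
    {v : Matrix (Fin n) (Fin n) ℝ} (hv : HasDerivAt (fun s => (γ s).1) v 0) (t : ℝ) :
    (γ t).1 = exp (t • (v * (γ 0).1 - (γ 0).1 * v)) * (γ 0).1 *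
      exp (t • -(v * (γ 0).1 - (γ 0).1 * v)) := by
  obtain ⟨γ', γ'', h⟩ := hγ
  have hv' : v = γ' 0 := hv.unique (h 0).1
  have hT : ∀ t, γ' t ∈ tangentSpace (γ t) := fun t => derivative_mem_tangentSpace (h t).1
  have hN : ∀ t, (γ t).1 * γ'' t = γ'' t * (γ t).1 := fun t =>
    (isNormal_iff_commute (γ t)
      (transpose_eq_of_hasDerivAt (h t).2.1 fun s => (hT s).1)).1 (h t).2.2
  have hc : ∀ t, HasDerivAt (fun s => γ' s * (γ s).1 - (γ s).1 * γ' s) 0 t := fun t =>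
    (((h t).2.1.mul (h t).1).sub ((h t).1.mul (h t).2.1)).congr_deriv (by rw [hN t]; abel)
  have hconst : ∀ t, γ' t * (γ t).1 - (γ t).1 * γ' t = v * (γ 0).1 - (γ 0).1 * v := fun t => by
    rw [hv']
    exact is_const_of_deriv_eq_zero (fun s => (hc s).differentiableAt)
      (fun s => (hc s).deriv) t 0
  refine eq_conj_exp_of_hasDerivAt _ (f := fun s => (γ s).1) (fun t => ?_) t
  refine (h t).1.congr_deriv ?_
  rw [← hconst t]
  exact (commutator_commutator_of_offDiagonal (γ t).2.2.1 (hT t).2).symm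

theorem transpose_angularVelocity {P : Gr n p} {v : Matrix (Fin n) (Fin n) ℝ}
    (hv : v ∈ tangentSpace P) : (v * P.1 - P.1 * v)ᵀ = -(v * P.1 - P.1 * v) := by
  rw [Matrix.transpose_sub, Matrix.transpose_mul, Matrix.transpose_mul, hv.1, P.2.1]
  abel

theorem transpose_exp_smul_of_skew {Ω : Matrix (Fin n) (Fin n) ℝ} (h : Ωᵀ = -Ω) (t : ℝ) :
    (exp (t • Ω))ᵀ = exp (t • -Ω) := by
  rw [← Matrix.exp_transpose, Matrix.transpose_smul, h]

/-- The isometry `P ↦ K P Kᵀ` of the Grassmannian, for an orthogonal matrix `K`. -/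
def conj (K : Matrix (Fin n) (Fin n) ℝ) (hK : Kᵀ * K = 1) (P : Gr n p) : Gr n p :=
  ⟨K * P.1 * Kᵀ, by
    simp only [Matrix.transpose_mul, Matrix.transpose_transpose, P.2.1, mul_assoc], by
    calc K * P.1 * Kᵀ * (K * P.1 * Kᵀ) = K * P.1 * (Kᵀ * K) * P.1 * Kᵀ := by
          simp only [mul_assoc]
      _ = K * P.1 * Kᵀ := by rw [hK, mul_one, mul_assoc K, P.2.2.1], by
    have hu : IsUnit K.det := (Matrix.isUnit_iff_isUnit_det _).1 (IsUnit.of_mul_eq_one_right _ hK)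
    rw [Matrix.rank_mul_eq_left_of_isUnit_det _ _ (by rwa [Matrix.det_transpose]),
      Matrix.rank_mul_eq_right_of_isUnit_det _ _ hu, P.2.2.2]⟩

/-- The rotation `e^{[v, P]}` which carries the point `P` along the geodesic with initial
velocity `v`. -/
noncomputable def rotation (P : Gr n p) (v : Matrix (Fin n) (Fin n) ℝ) : Matrix (Fin n) (Fin n) ℝ :=
  exp (v * P.1 - P.1 * v)

theorem rotation_smul (P : Gr n p) (v : Matrix (Fin n) (Fin n) ℝ) (t : ℝ) :
    rotation P (t • v) = exp (t • (v * P.1 - P.1 * v)) := by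
  rw [rotation, smul_mul_assoc, mul_smul_comm, smul_sub]

theorem transpose_rotation {P : Gr n p} {v : Matrix (Fin n) (Fin n) ℝ} (hv : v ∈ tangentSpace P) :
    (rotation P v)ᵀ = exp (-(v * P.1 - P.1 * v)) := by
  simpa [rotation] using transpose_exp_smul_of_skew (transpose_angularVelocity hv) 1

theorem rotation_neg {P : Gr n p} {v : Matrix (Fin n) (Fin n) ℝ} (hv : v ∈ tangentSpace P) :
    rotation P (-v) = (rotation P v)ᵀ := by
  rw [transpose_rotation hv, rotation]
  congr 1
  noncomm_ring

theorem transpose_mul_rotation {P : Gr n p} {v : Matrix (Fin n) (Fin n) ℝ}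
    (hv : v ∈ tangentSpace P) : (rotation P v)ᵀ * rotation P v = 1 := by
  rw [transpose_rotation hv]
  simpa [rotation] using exp_smul_neg_mul_exp_smul (v * P.1 - P.1 * v) 1

/-- The curve `e^{tΩ} P e^{-tΩ}` with `Ω = [v, P]`. -/
noncomputable def geodesic (P : Gr n p) (v : Matrix (Fin n) (Fin n) ℝ) (hv : v ∈ tangentSpace P)
    (t : ℝ) : Gr n p :=
  conj (rotation P (t • v)) (transpose_mul_rotation (Submodule.smul_mem _ t hv)) P

theorem geodesic_coe {P : Gr n p} {v : Matrix (Fin n) (Fin n) ℝ} (hv : v ∈ tangentSpace P) (t : ℝ) :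
    (geodesic P v hv t).1 =
      exp (t • (v * P.1 - P.1 * v)) * P.1 * exp (t • -(v * P.1 - P.1 * v)) := by
  simp only [geodesic, conj]
  rw [rotation_smul, transpose_exp_smul_of_skew (transpose_angularVelocity hv)]

theorem commute_exp_smul (Ω : Matrix (Fin n) (Fin n) ℝ) (t : ℝ) :
    Ω * exp (t • Ω) = exp (t • Ω) * Ω :=
  ((Commute.refl Ω).smul_right t).exp_right.eq

theorem commute_exp_smul_neg (Ω : Matrix (Fin n) (Fin n) ℝ) (t : ℝ) :
    Ω * exp (t • -Ω) = exp (t • -Ω) * Ω :=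
  ((Commute.refl Ω).neg_right.smul_right t).exp_right.eq

theorem hasDerivAt_geodesic {P : Gr n p} {v : Matrix (Fin n) (Fin n) ℝ} (hv : v ∈ tangentSpace P)
    (t : ℝ) : HasDerivAt (fun s => (geodesic P v hv s).1)
      ((v * P.1 - P.1 * v) * (geodesic P v hv t).1 -
        (geodesic P v hv t).1 * (v * P.1 - P.1 * v)) t := by
  simp only [geodesic_coe]
  refine (hasDerivAt_conj_exp (v * P.1 - P.1 * v) (hasDerivAt_const t P.1)).congr_deriv ?_
  generalize v * P.1 - P.1 * v = Ω
  have h1 := commute_exp_smul Ω t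
  have h2 := commute_exp_smul_neg Ω t
  generalize exp (t • Ω) = E at *
  generalize exp (t • -Ω) = F at *
  rw [zero_add, mul_assoc (E * P.1), ← h2, mul_sub, sub_mul, ← mul_assoc E, ← h1]
  noncomm_ring

theorem geodesic_zero {P : Gr n p} {v : Matrix (Fin n) (Fin n) ℝ} (hv : v ∈ tangentSpace P) :
    geodesic P v hv 0 = P := by
  apply Subtype.ext
  rw [geodesic_coe]
  simp

/-- The angular velocity is off-diagonal with respect to every point of its geodesic. -/
theorem geodesic_mul_angularVelocity {P : Gr n p} {v : Matrix (Fin n) (Fin n) ℝ}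
    (hv : v ∈ tangentSpace P) (t : ℝ) :
    (geodesic P v hv t).1 * (v * P.1 - P.1 * v) + (v * P.1 - P.1 * v) * (geodesic P v hv t).1 =
      v * P.1 - P.1 * v := by
  have h0 : P.1 * (v * P.1 - P.1 * v) + (v * P.1 - P.1 * v) * P.1 = v * P.1 - P.1 * v :=
    commutator_offDiagonal P.2.2.1
  rw [geodesic_coe]
  generalize v * P.1 - P.1 * v = Ω at *
  have h1 := commute_exp_smul Ω t
  have h2 := commute_exp_smul_neg Ω t
  have h3 := exp_smul_mul_exp_smul_neg Ω t
  generalize exp (t • Ω) = E at *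
  generalize exp (t • -Ω) = F at *
  calc E * P.1 * F * Ω + Ω * (E * P.1 * F) = E * P.1 * (F * Ω) + (Ω * E) * P.1 * F := by
        noncomm_ring
    _ = E * (P.1 * Ω + Ω * P.1) * F := by rw [← h2, h1]; noncomm_ring
    _ = (Ω * E) * F := by rw [h0, h1]
    _ = Ω := by rw [mul_assoc, h3, mul_one]

theorem isGeodesic_geodesic {P : Gr n p} {v : Matrix (Fin n) (Fin n) ℝ} (hv : v ∈ tangentSpace P) :
    IsGeodesic (geodesic P v hv) := by
  set Ω := v * P.1 - P.1 * v with hΩ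
  have hd := hasDerivAt_geodesic hv
  rw [← hΩ] at hd
  refine ⟨_, fun t => Ω * (Ω * (geodesic P v hv t).1 - (geodesic P v hv t).1 * Ω) -
    (Ω * (geodesic P v hv t).1 - (geodesic P v hv t).1 * Ω) * Ω, fun t => ⟨hd t, ?_, ?_⟩⟩
  · exact ((hd t).const_mul Ω).sub ((hd t).mul_const Ω)
  · have hs : Ωᵀ = -Ω := transpose_angularVelocity hv
    have h1 := geodesic_mul_angularVelocity hv t
    rw [← hΩ] at h1
    have h2 := (geodesic P v hv t).2.2.1
    rw [isNormal_iff_commute]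
    · exact commute_commutator_of_offDiagonal h1 (commutator_offDiagonal h2)
    · simp only [Matrix.transpose_sub, Matrix.transpose_mul, hs, (geodesic P v hv t).2.1]
      noncomm_ring

theorem expMap_eq_geodesic {P : Gr n p} {v : Matrix (Fin n) (Fin n) ℝ} (hv : v ∈ tangentSpace P) :
    expMap P v = geodesic P v hv 1 := by
  have h : ∃ γ : ℝ → Gr n p, IsGeodesic γ ∧ γ 0 = P ∧ HasDerivAt (fun s => (γ s).1) v 0 := by
    refine ⟨geodesic P v hv, isGeodesic_geodesic hv, geodesic_zero hv, ?_⟩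
    refine (hasDerivAt_geodesic hv 0).congr_deriv ?_
    rw [geodesic_zero]
    exact commutator_commutator_of_offDiagonal P.2.2.1 hv.2
  rw [expMap, dif_pos h]
  obtain ⟨h1, h2, h3⟩ := h.choose_spec
  apply Subtype.ext
  rw [h1.eq_conj_exp h3 1, h2, geodesic_coe]

/-- The exponential map in closed form: `Exp_P(v) = e^{[v, P]} P e^{-[v, P]}`. -/
theorem expMap_coe {P : Gr n p} {v : Matrix (Fin n) (Fin n) ℝ} (hv : v ∈ tangentSpace P) :
    (expMap P v).1 = rotation P v * P.1 * (rotation P v)ᵀ := by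
  rw [expMap_eq_geodesic hv, geodesic, conj]
  simp

theorem expMap_smul {P : Gr n p} {v : Matrix (Fin n) (Fin n) ℝ} (hv : v ∈ tangentSpace P) (t : ℝ) :
    expMap P (t • v) = geodesic P v hv t := by
  rw [expMap_eq_geodesic (Submodule.smul_mem _ t hv)]
  simp [geodesic]

/-- A parallel field along a geodesic is carried by the same rotations as the geodesic itself. -/
theorem IsParallelAlong.eq_conj_exp {P : Gr n p} {v : Matrix (Fin n) (Fin n) ℝ}
    (hv : v ∈ tangentSpace P) {W : ℝ → Matrix (Fin n) (Fin n) ℝ}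
    (hW : IsParallelAlong (geodesic P v hv) W) (t : ℝ) :
    W t = exp (t • (v * P.1 - P.1 * v)) * W 0 * exp (t • -(v * P.1 - P.1 * v)) := by
  obtain ⟨hT, W', h⟩ := hW
  refine eq_conj_exp_of_hasDerivAt _ (fun t => (h t).1.congr_deriv ?_) t
  have hN := (isNormal_iff_commute (geodesic P v hv t)
      (transpose_eq_of_hasDerivAt (h t).1 fun s => (hT s).1)).1 (h t).2
  have hd := hasDerivAt_geodesic hv t
  have hΩ := geodesic_mul_angularVelocity hv t
  have hPP := (geodesic P v hv t).2.2.1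
  have hW := (hT t).2
  generalize v * P.1 - P.1 * v = Ω at *
  -- the derivative of the tangency condition determines `W'`, which commutes with the base point
  have h1 := ((hd.mul (h t).1).add ((h t).1.mul hd)).unique
    ((h t).1.congr_of_eventuallyEq (Filter.Eventually.of_forall fun s => (hT s).2))
  exact eq_commutator_of_offDiagonal hPP hΩ hW hN h1

theorem mem_tangentSpace_conj {K : Matrix (Fin n) (Fin n) ℝ} (hK : Kᵀ * K = 1) {P : Gr n p}
    {v : Matrix (Fin n) (Fin n) ℝ} (hv : v ∈ tangentSpace P) :
    K * v * Kᵀ ∈ tangentSpace (conj K hK P) := by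
  refine ⟨by simp only [Matrix.transpose_mul, Matrix.transpose_transpose, hv.1, mul_assoc], ?_⟩
  simp only [conj]
  calc K * P.1 * Kᵀ * (K * v * Kᵀ) + K * v * Kᵀ * (K * P.1 * Kᵀ)
      = K * P.1 * (Kᵀ * K) * v * Kᵀ + K * v * (Kᵀ * K) * P.1 * Kᵀ := by noncomm_ring
    _ = K * (P.1 * v + v * P.1) * Kᵀ := by rw [hK]; noncomm_ring
    _ = _ := by rw [hv.2]

theorem isParallelAlong_conj_exp {P : Gr n p} {v w : Matrix (Fin n) (Fin n) ℝ}
    (hv : v ∈ tangentSpace P) (hw : w ∈ tangentSpace P) :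
    IsParallelAlong (geodesic P v hv) (fun t => exp (t • (v * P.1 - P.1 * v)) * w *
      exp (t • -(v * P.1 - P.1 * v))) := by
  have hT : ∀ t, exp (t • (v * P.1 - P.1 * v)) * w * exp (t • -(v * P.1 - P.1 * v)) ∈
      tangentSpace (geodesic P v hv t) := fun t => by
    have := mem_tangentSpace_conj (transpose_mul_rotation (Submodule.smul_mem _ t hv)) hw
    rw [← rotation_smul, ← transpose_exp_smul_of_skew (transpose_angularVelocity hv),
      ← rotation_smul]
    exact this
  refine ⟨hT, _, fun t => ⟨hasDerivAt_conj_exp _ (hasDerivAt_const t w), ?_⟩⟩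
  have hΩ := geodesic_mul_angularVelocity hv t
  have hs : (v * P.1 - P.1 * v)ᵀ = -(v * P.1 - P.1 * v) := transpose_angularVelocity hv
  have hE := transpose_exp_smul_of_skew hs t
  have hw1 := (hT t).2
  generalize v * P.1 - P.1 * v = Ω at *
  have h1 := commute_exp_smul Ω t
  have h2 := commute_exp_smul_neg Ω t
  rw [isNormal_iff_commute]
  · generalize exp (t • Ω) = E at *
    generalize exp (t • -Ω) = F at *
    have h3 : E * (0 + (Ω * w - w * Ω)) * F = Ω * (E * w * F) - (E * w * F) * Ω := by
      rw [zero_add, mul_assoc (E * w), ← h2, mul_sub, sub_mul, ← mul_assoc E, ← h1]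
      noncomm_ring
    rw [h3]
    have hPP := (geodesic P v hv t).2.2.1
    exact commute_commutator_of_offDiagonal hΩ hw1
  · have hF : (exp (t • -Ω))ᵀ = exp (t • Ω) := by rw [← hE, Matrix.transpose_transpose]
    simp only [Matrix.transpose_sub, Matrix.transpose_add, Matrix.transpose_zero,
      Matrix.transpose_mul, hs, hw.1, hE, hF]
    noncomm_ring

/-- Parallel transport in closed form. -/
theorem transport_eq {P Q : Gr n p} (hlog : logMap P Q ∈ tangentSpace P)
    {w : Matrix (Fin n) (Fin n) ℝ} (hw : w ∈ tangentSpace P) :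
    transport P Q w = rotation P (logMap P Q) * w * (rotation P (logMap P Q))ᵀ := by
  have hcurve : (fun t : ℝ => expMap P (t • logMap P Q)) = geodesic P (logMap P Q) hlog :=
    funext fun t => expMap_smul hlog t
  have h : ∃ W, IsParallelAlong (fun t : ℝ => expMap P (t • logMap P Q)) W ∧ W 0 = w := by
    rw [hcurve]
    exact ⟨_, isParallelAlong_conj_exp hlog hw, by simp⟩
  rw [transport, dif_pos h]
  obtain ⟨h1, h2⟩ := h.choose_spec
  rw [transpose_rotation hlog]
  have h3 : IsParallelAlong (geodesic P (logMap P Q) hlog) h.choose := hcurve ▸ h1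
  rw [h3.eq_conj_exp hlog 1, h2, one_smul, one_smul, rotation]

end Geodesics

/-! ### Functional calculus of symmetric matrices -/

section FunctionalCalculus

variable {n : ℕ} {v S : Matrix (Fin n) (Fin n) ℝ}

theorem continuousOn_spectrum (f : ℝ → ℝ) (v : Matrix (Fin n) (Fin n) ℝ) :
    ContinuousOn f (spectrum ℝ v) :=
  v.finite_real_spectrum.continuousOn f

theorem cfc_mul_matrix (f g : ℝ → ℝ) (v : Matrix (Fin n) (Fin n) ℝ) :
    cfc (fun x => f x * g x) v = cfc f v * cfc g v :=
  cfc_mul f g v (continuousOn_spectrum f v) (continuousOn_spectrum g v)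

theorem cfc_add_matrix (f g : ℝ → ℝ) (v : Matrix (Fin n) (Fin n) ℝ) :
    cfc (fun x => f x + g x) v = cfc f v + cfc g v :=
  cfc_add v f g (continuousOn_spectrum f v) (continuousOn_spectrum g v)

theorem cfc_sub_matrix (f g : ℝ → ℝ) (v : Matrix (Fin n) (Fin n) ℝ) :
    cfc (fun x => f x - g x) v = cfc f v - cfc g v :=
  cfc_sub f g v (continuousOn_spectrum f v) (continuousOn_spectrum g v)

theorem isSelfAdjoint_of_transpose_eq (hv : vᵀ = v) : IsSelfAdjoint v := by
  rw [isSelfAdjoint_iff, Matrix.star_eq_conjTranspose,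
    Matrix.conjTranspose_eq_transpose_of_trivial, hv]

theorem transpose_cfc (f : ℝ → ℝ) (v : Matrix (Fin n) (Fin n) ℝ) : (cfc f v)ᵀ = cfc f v := by
  have h : IsSelfAdjoint (cfc f v) := cfc_predicate f v
  rwa [isSelfAdjoint_iff, Matrix.star_eq_conjTranspose,
    Matrix.conjTranspose_eq_transpose_of_trivial] at h

theorem cfc_comp_matrix (f g : ℝ → ℝ) (hv : vᵀ = v) :
    cfc (fun x => f (g x)) v = cfc f (cfc g v) := by
  refine cfc_comp' f g v ?_ (continuousOn_spectrum g v) (isSelfAdjoint_of_transpose_eq hv)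
  exact (v.finite_real_spectrum.image g).continuousOn f

theorem cfc_eq_self (hv : vᵀ = v) : cfc (fun x : ℝ => x) v = v :=
  cfc_id' ℝ v (isSelfAdjoint_of_transpose_eq hv)

theorem spectrum_cfc (f : ℝ → ℝ) (hv : vᵀ = v) : spectrum ℝ (cfc f v) = f '' spectrum ℝ v :=
  cfc_map_spectrum f v (isSelfAdjoint_of_transpose_eq hv) (continuousOn_spectrum f v)

theorem mul_cfc_of_commute (hv : vᵀ = v) (h : S * v = v * S) (f : ℝ → ℝ) :
    S * cfc f v = cfc f v * S := by
  have h' : Commute v S := h.symm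
  refine (Commute.cfc h' ?_ f).eq.symm
  rwa [(isSelfAdjoint_of_transpose_eq hv).star_eq]

/-- An even function of `v` is a function of `v ^ 2`, so it commutes with everything that
anticommutes with `v`. -/
theorem mul_cfc_of_even (hv : vᵀ = v) (h : S * v = -(v * S)) {f : ℝ → ℝ}
    (hf : ∀ x, f (-x) = f x) : S * cfc f v = cfc f v * S := by
  have hfx : (fun x => f x) = fun x => f √(x * x) := by
    funext x
    rw [Real.sqrt_mul_self_eq_abs]
    rcases abs_choice x with hx | hx <;> rw [hx]
    exact (hf x).symm
  have hsq : cfc (fun x : ℝ => x * x) v = v * v := by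
    rw [cfc_mul_matrix, cfc_eq_self hv]
  rw [show f = fun x => f √(x * x) from hfx,
    cfc_comp_matrix (fun y => f √y) (fun x => x * x) hv, hsq]
  refine mul_cfc_of_commute ?_ ?_ _
  · rw [Matrix.transpose_mul, hv]
  · rw [← mul_assoc, h, neg_mul, mul_assoc, h]
    noncomm_ring

/-- An odd function of `v` is `v` times an even one. -/
theorem mul_cfc_of_odd (hv : vᵀ = v) (h : S * v = -(v * S)) {f : ℝ → ℝ}
    (hf : ∀ x, f (-x) = -f x) : S * cfc f v = -(cfc f v * S) := by
  have h0 : f 0 = 0 := by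
    have := hf 0
    rw [neg_zero] at this
    linarith
  have hfx : f = fun x => x * (f x / x) := by
    funext x
    rcases eq_or_ne x 0 with rfl | hx
    · simp [h0]
    · field_simp
  have he : S * cfc (fun x => f x / x) v = cfc (fun x => f x / x) v * S :=
    mul_cfc_of_even hv h fun x => by rw [hf, neg_div_neg_eq]
  rw [hfx, cfc_mul_matrix, cfc_eq_self hv, ← mul_assoc, h, neg_mul, mul_assoc, he, mul_assoc]

theorem trace_cfc (f : ℝ → ℝ) (hv : v.IsHermitian) :
    (cfc f v).trace = ∑ i, f (hv.eigenvalues i) := by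
  rw [hv.cfc_eq, Matrix.IsHermitian.cfc, Unitary.conjStarAlgAut_apply, Matrix.trace_mul_cycle,
    Unitary.coe_star_mul_self, one_mul, Matrix.trace_diagonal]
  rfl

open scoped Matrix.Norms.Operator in
theorem hasDerivAt_cfc {f : ℝ → ℝ → ℝ} {f' : ℝ → ℝ} {t : ℝ} (hv : vᵀ = v)
    (hf : ∀ x, HasDerivAt (fun s => f s x) (f' x) t) :
    HasDerivAt (fun s => cfc (f s) v) (cfc f' v) t := by
  have hv' : v.IsHermitian := isSelfAdjoint_of_transpose_eq hv
  simp only [hv'.cfc_eq, Matrix.IsHermitian.cfc, Unitary.conjStarAlgAut_apply]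
  refine HasDerivAt.mul_const (HasDerivAt.const_mul _ ?_) _
  refine hasDerivAt_pi.2 fun i => hasDerivAt_pi.2 fun j => ?_
  simp only [Matrix.diagonal_apply]
  split_ifs
  · exact hf _
  · exact hasDerivAt_const _ _

open scoped Matrix.Norms.Operator in
open NormedSpace (exp) in
/-- De Moivre's formula: `v * S` squares to `-v ^ 2` when the involution `S` anticommutes with
`v`. -/
theorem exp_smul_mul_involution (hv : vᵀ = v) (hS : S * S = 1) (h : S * v = -(v * S)) (t : ℝ) :
    exp (t • (v * S)) =
      cfc (fun x => Real.cos (t * x)) v + cfc (fun x => Real.sin (t * x)) v * S := by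
  set G : ℝ → Matrix (Fin n) (Fin n) ℝ := fun t =>
    cfc (fun x => Real.cos (t * x)) v + cfc (fun x => Real.sin (t * x)) v * S with hG
  have hd : ∀ t, HasDerivAt G (G t * (v * S)) t := by
    intro t
    have h1 : HasDerivAt (fun s => cfc (fun x => Real.cos (s * x)) v)
        (cfc (fun x => - Real.sin (t * x) * x) v) t :=
      hasDerivAt_cfc hv fun x => by
        simpa using (hasDerivAt_mul_const x).cos
    have h2 : HasDerivAt (fun s => cfc (fun x => Real.sin (s * x)) v)
        (cfc (fun x => Real.cos (t * x) * x) v) t :=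
      hasDerivAt_cfc hv fun x => by
        simpa using (hasDerivAt_mul_const x).sin
    refine (h1.add (h2.mul_const S)).congr_deriv ?_
    have h3 : cfc (fun x => - Real.sin (t * x) * x) v =
        -(cfc (fun x => Real.sin (t * x)) v * v) := by
      rw [cfc_mul_matrix, cfc_eq_self hv, cfc_neg, neg_mul]
    have h4 : cfc (fun x => Real.cos (t * x) * x) v = cfc (fun x => Real.cos (t * x)) v * v := by
      rw [cfc_mul_matrix, cfc_eq_self hv]
    rw [h3, h4]
    simp only [hG]
    linear_combination (norm := noncomm_ring)
      -(cfc (fun x => Real.sin (t * x)) v * h * S) + cfc (fun x => Real.sin (t * x)) v * v * hS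
  have hc : ∀ s, HasDerivAt (fun s => G s * exp (s • -(v * S))) 0 s := fun s => by
    refine ((hd s).mul (hasDerivAt_exp_smul_const' (𝕂 := ℝ) (-(v * S)) s)).congr_deriv ?_
    rw [neg_mul, mul_neg, mul_assoc (G s) (v * S), add_neg_cancel]
  have h1 := is_const_of_deriv_eq_zero (fun s => (hc s).differentiableAt)
    (fun s => (hc s).deriv) t 0
  have h0 : G 0 = 1 := by
    simp only [hG, zero_mul, Real.cos_zero, Real.sin_zero]
    rw [cfc_const_one ℝ v (isSelfAdjoint_of_transpose_eq hv), cfc_const_zero, zero_mul, add_zero]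
  rw [h0, zero_smul, NormedSpace.exp_zero, one_mul] at h1
  calc exp (t • (v * S)) = G t * exp (t • -(v * S)) * exp (t • (v * S)) := by rw [h1, one_mul]
    _ = G t := by rw [mul_assoc, exp_smul_neg_mul_exp_smul, mul_one]

end FunctionalCalculus

/-! ### The exponential map in terms of reflections -/

section Reflections

variable {n p : ℕ}

/-- The orthogonal reflection `2 P - 1` that fixes the range of `P`. -/
def reflection (P : Gr n p) : Matrix (Fin n) (Fin n) ℝ := 2 * P.1 - 1

theorem reflection_mul_self (P : Gr n p) : reflection P * reflection P = 1 := by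
  unfold reflection
  linear_combination (norm := noncomm_ring) 4 * P.2.2.1

theorem transpose_reflection (P : Gr n p) : (reflection P)ᵀ = reflection P := by
  simp [reflection, two_mul, P.2.1]

theorem reflection_injective : Function.Injective (reflection (n := n) (p := p)) := by
  intro P Q h
  unfold reflection at h
  have h2 : (2 : ℝ) • P.1 = (2 : ℝ) • Q.1 := by
    rw [two_smul, two_smul]
    linear_combination (norm := noncomm_ring) h
  exact Subtype.ext (smul_right_injective _ (two_ne_zero' ℝ) h2)

/-- The tangent vectors at `P` are the symmetric matrices that anticommute with the reflection. -/
theorem mem_tangentSpace_iff {P : Gr n p} {v : Matrix (Fin n) (Fin n) ℝ} :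
    v ∈ tangentSpace P ↔ vᵀ = v ∧ reflection P * v = -(v * reflection P) := by
  refine and_congr_right fun _ => ?_
  unfold reflection
  constructor
  · intro h
    linear_combination (norm := noncomm_ring) 2 * h
  · intro h
    have h2 : (2 : ℝ) • (P.1 * v + v * P.1) = (2 : ℝ) • v := by
      rw [two_smul, two_smul]
      linear_combination (norm := noncomm_ring) h
    exact smul_right_injective _ (two_ne_zero' ℝ) h2

theorem cfc_mem_tangentSpace {P : Gr n p} {v : Matrix (Fin n) (Fin n) ℝ} (hv : v ∈ tangentSpace P)
    {f : ℝ → ℝ} (hf : ∀ x, f (-x) = -f x) : cfc f v ∈ tangentSpace P := by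
  rw [mem_tangentSpace_iff] at hv ⊢
  exact ⟨transpose_cfc f v, mul_cfc_of_odd hv.1 hv.2 hf⟩

theorem rotation_eq_cfc {P : Gr n p} {v : Matrix (Fin n) (Fin n) ℝ} (hv : v ∈ tangentSpace P) :
    rotation P v = cfc Real.cos v + cfc Real.sin v * reflection P := by
  have h := mem_tangentSpace_iff.1 hv
  have h1 := exp_smul_mul_involution h.1 (reflection_mul_self P) h.2 1
  simp only [one_smul, one_mul] at h1
  rw [← h1, rotation]
  congr 1
  unfold reflection
  linear_combination (norm := noncomm_ring) -hv.2

theorem reflection_expMap {P : Gr n p} {v : Matrix (Fin n) (Fin n) ℝ} (hv : v ∈ tangentSpace P) :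
    reflection (expMap P v) =
      cfc (fun x => Real.cos (2 * x)) v * reflection P + cfc (fun x => Real.sin (2 * x)) v := by
  have h := mem_tangentSpace_iff.1 hv
  have hR := transpose_mul_rotation hv
  have hR' : rotation P v * (rotation P v)ᵀ = 1 := mul_eq_one_comm.1 hR
  have hC := mul_cfc_of_even h.1 h.2 Real.cos_neg
  have hs := mul_cfc_of_odd h.1 h.2 Real.sin_neg
  have h1 : reflection (expMap P v) = rotation P v * reflection P * (rotation P v)ᵀ := by
    unfold reflection
    rw [expMap_coe hv]
    linear_combination (norm := noncomm_ring) hR'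
  have h2 : cfc (fun x => Real.cos (2 * x)) v =
      cfc Real.cos v * cfc Real.cos v - cfc Real.sin v * cfc Real.sin v := by
    simp only [Real.cos_two_mul', pow_two]
    rw [cfc_sub_matrix, cfc_mul_matrix, cfc_mul_matrix]
  have h3 : cfc (fun x => Real.sin (2 * x)) v =
      cfc Real.sin v * cfc Real.cos v + cfc Real.sin v * cfc Real.cos v := by
    rw [← cfc_mul_matrix, ← cfc_add_matrix]
    congr 1
    funext x
    rw [Real.sin_two_mul]; ring
  have h4 : cfc Real.sin v * cfc Real.cos v = cfc Real.cos v * cfc Real.sin v := by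
    rw [← cfc_mul_matrix, ← cfc_mul_matrix]
    simp only [mul_comm]
  have hS := reflection_mul_self P
  rw [h1, h2, h3, rotation_eq_cfc hv, Matrix.transpose_add, Matrix.transpose_mul, transpose_cfc,
    transpose_cfc, transpose_reflection, hs]
  generalize cfc Real.cos v = C at *
  generalize cfc Real.sin v = T at *
  generalize reflection P = S at *
  linear_combination (norm := noncomm_ring)
    C * hC - C * hs * S + C * T * hS + T * hS * C - T * hS * T * S - h4

end Reflections

/-! ### Minimizing velocities -/

section Minimizing

variable {n p : ℕ} {P : Gr n p} {u v : Matrix (Fin n) (Fin n) ℝ}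

theorem expMap_eq_of_cfc_eq (hu : u ∈ tangentSpace P) (hv : v ∈ tangentSpace P)
    (hc : cfc (fun x => Real.cos (2 * x)) u = cfc (fun x => Real.cos (2 * x)) v)
    (hs : cfc (fun x => Real.sin (2 * x)) u = cfc (fun x => Real.sin (2 * x)) v) :
    expMap P u = expMap P v := by
  apply reflection_injective
  rw [reflection_expMap hu, reflection_expMap hv, hc, hs]

/-- The endpoint of a geodesic determines `cos (2 v)` and `sin (2 v)`, which are read off from the
part of its reflection that anticommutes with the reflection of `P`, and the part that commutes. -/
theorem cfc_eq_of_expMap_eq (hu : u ∈ tangentSpace P) (hv : v ∈ tangentSpace P)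
    (h : expMap P u = expMap P v) :
    cfc (fun x => Real.cos (2 * x)) u = cfc (fun x => Real.cos (2 * x)) v ∧
      cfc (fun x => Real.sin (2 * x)) u = cfc (fun x => Real.sin (2 * x)) v := by
  have h0 := congrArg reflection h
  rw [reflection_expMap hu, reflection_expMap hv] at h0
  have hu' := mem_tangentSpace_iff.1 hu
  have hv' := mem_tangentSpace_iff.1 hv
  have hcu := mul_cfc_of_even hu'.1 hu'.2 (f := fun x => Real.cos (2 * x)) (by simp)
  have hcv := mul_cfc_of_even hv'.1 hv'.2 (f := fun x => Real.cos (2 * x)) (by simp)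
  have hsu := mul_cfc_of_odd hu'.1 hu'.2 (f := fun x => Real.sin (2 * x)) (by simp)
  have hsv := mul_cfc_of_odd hv'.1 hv'.2 (f := fun x => Real.sin (2 * x)) (by simp)
  have hS := reflection_mul_self P
  generalize reflection P = S at *
  generalize cfc (fun x => Real.cos (2 * x)) u = a at *
  generalize cfc (fun x => Real.cos (2 * x)) v = b at *
  generalize cfc (fun x => Real.sin (2 * x)) u = c at *
  generalize cfc (fun x => Real.sin (2 * x)) v = d at *
  have h1 : c = d := by
    refine smul_right_injective _ (two_ne_zero' ℝ) ?_
    simp only [two_smul]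
    linear_combination (norm := noncomm_ring)
      h0 - S * h0 * S + (hcu - hcv) * S * S + a * S * hS - b * S * hS + (hsu - hsv) * S
      - c * hS + d * hS
  refine ⟨?_, h1⟩
  linear_combination (norm := noncomm_ring) h0 * S - h1 * S - a * hS + b * hS

theorem metric_self_eq_trace (hv : vᵀ = v) : metric v v = 1 / 2 * (v * v).trace := by
  rw [metric, hv]

theorem metric_cfc (f : ℝ → ℝ) (hv : v.IsHermitian) :
    metric (cfc f v) (cfc f v) = 1 / 2 * ∑ i, f (hv.eigenvalues i) * f (hv.eigenvalues i) := by
  rw [metric_self_eq_trace (transpose_cfc f v), ← cfc_mul_matrix, trace_cfc _ hv]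

/-- The principal angles of a minimizing velocity are at most `π / 2`: a larger angle `x` can be
replaced by the shorter `x - π` without moving the endpoint. -/
theorem IsMinimizing.abs_le_of_mem_spectrum (hv : IsMinimizing P v) {x : ℝ}
    (hx : x ∈ spectrum ℝ v) : |x| ≤ Real.pi / 2 := by
  by_contra! hlt
  have hpi := Real.pi_pos
  have hT := (mem_tangentSpace_iff.1 hv.1).1
  have hH : v.IsHermitian := isSelfAdjoint_of_transpose_eq hT
  -- a shift by `π` changes neither `cos (2 x)` nor `sin (2 x)`
  set f : ℝ → ℝ := fun y =>
    if Real.pi / 2 < y then y - Real.pi else if y < -(Real.pi / 2) then y + Real.pi else y with hf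
  have hodd : ∀ y, f (-y) = -f y := by
    intro y
    simp only [hf]
    split_ifs <;> linarith
  have hcos : ∀ y, Real.cos (2 * f y) = Real.cos (2 * y) := by
    intro y
    simp only [hf]
    split_ifs
    · rw [mul_sub, Real.cos_sub_two_pi]
    · rw [mul_add, Real.cos_add_two_pi]
    · rfl
  have hsin : ∀ y, Real.sin (2 * f y) = Real.sin (2 * y) := by
    intro y
    simp only [hf]
    split_ifs
    · rw [mul_sub, Real.sin_sub_two_pi]
    · rw [mul_add, Real.sin_add_two_pi]
    · rfl
  have hlt' : ∀ y, Real.pi / 2 < |y| → f y * f y < y * y := by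
    intro y hy
    simp only [hf]
    rcases lt_abs.1 hy with h | h
    · rw [if_pos h]; nlinarith
    · rw [if_neg (by linarith), if_pos (by linarith)]; nlinarith
  have hle : ∀ y, f y * f y ≤ y * y := by
    intro y
    rcases lt_or_ge (Real.pi / 2) |y| with h | h
    · exact (hlt' y h).le
    · simp only [hf]
      rw [if_neg (by linarith [le_abs_self y]), if_neg (by linarith [neg_abs_le y])]
  have hmem := cfc_mem_tangentSpace hv.1 hodd
  have hend : expMap P (cfc f v) = expMap P v := by
    refine expMap_eq_of_cfc_eq hmem hv.1 ?_ ?_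
    · rw [← cfc_comp_matrix (fun x => Real.cos (2 * x)) f hT]
      simp only [hcos]
    · rw [← cfc_comp_matrix (fun x => Real.sin (2 * x)) f hT]
      simp only [hsin]
  have hmin := hv.2 _ hmem hend
  have hv2 : metric v v = metric (cfc (fun x : ℝ => x) v) (cfc (fun x : ℝ => x) v) := by
    rw [cfc_eq_self hT]
  rw [hv2, metric_cfc _ hH, metric_cfc _ hH] at hmin
  rw [hH.spectrum_real_eq_range_eigenvalues] at hx
  obtain ⟨i, rfl⟩ := hx
  have := Finset.sum_lt_sum (fun j _ => hle (hH.eigenvalues j)) ⟨i, Finset.mem_univ i, hlt' _ hlt⟩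
  linarith

theorem abs_lt_of_isMinimizing_smul (hv : v ∈ tangentSpace P) {s : ℝ} (hs : 1 < s)
    (hsv : IsMinimizing P (s • v)) {x : ℝ} (hx : x ∈ spectrum ℝ v) : |x| < Real.pi / 2 := by
  have hT := (mem_tangentSpace_iff.1 hv).1
  have hmem : s * x ∈ spectrum ℝ (s • v) := by
    rw [← cfc_const_mul_id s v (isSelfAdjoint_of_transpose_eq hT), spectrum_cfc _ hT]
    exact ⟨x, hx, rfl⟩
  have h := hsv.abs_le_of_mem_spectrum hmem
  rw [abs_mul, abs_of_pos (by linarith)] at h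
  have hpi := Real.pi_pos
  nlinarith [abs_nonneg x]

/-- If all principal angles are less than `π / 2`, then `v = arctan (sin (2 v) / (1 + cos (2 v)))`
is determined by `cos (2 v)` and `sin (2 v)`. -/
theorem eq_cfc_arctan (hv : vᵀ = v) (h : ∀ x ∈ spectrum ℝ v, |x| < Real.pi / 2) :
    v = cfc Real.arctan (cfc (fun x => Real.sin (2 * x)) v *
      cfc (fun y : ℝ => (1 + y)⁻¹) (cfc (fun x => Real.cos (2 * x)) v)) := by
  rw [← cfc_comp_matrix _ _ hv, ← cfc_mul_matrix, ← cfc_comp_matrix _ _ hv]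
  conv_lhs => rw [← cfc_eq_self hv]
  refine cfc_congr fun x hx => ?_
  obtain ⟨h1, h2⟩ := abs_lt.1 (h x hx)
  have hc : 0 < Real.cos x := Real.cos_pos_of_mem_Ioo ⟨h1, h2⟩
  have : Real.sin (2 * x) * (1 + Real.cos (2 * x))⁻¹ = Real.tan x := by
    rw [Real.sin_two_mul, Real.cos_two_mul, Real.tan_eq_sin_div_cos]
    field_simp
    ring
  simp only [this, Real.arctan_tan h1 h2]

/-- Outside of the cut locus the minimizing velocity is unique. -/
theorem isMinimizing_unique (hu : IsMinimizing P u) (hv : IsMinimizing P v)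
    (h : expMap P u = expMap P v) (hcut : expMap P v ∉ cutLocus P) : u = v := by
  have key : ∀ w, IsMinimizing P w → expMap P w = expMap P v →
      ∀ x ∈ spectrum ℝ w, |x| < Real.pi / 2 := by
    intro w hw hwv x hx
    by_contra hlt
    exact hcut ⟨w, hw, hwv, fun s hs hsw => hlt (abs_lt_of_isMinimizing_smul hw.1 hs hsw hx)⟩
  obtain ⟨hc, hs⟩ := cfc_eq_of_expMap_eq hu.1 hv.1 h
  rw [eq_cfc_arctan hu.1.1 (key u hu h), eq_cfc_arctan hv.1.1 (key v hv rfl), hc, hs]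

end Minimizing

/-! ### Orthogonal projections and partial isometries -/

section PartialIsometries

variable {n : ℕ} {E F : Matrix (Fin n) (Fin n) ℝ}

/-- An orthogonal projection `E` is `V Vᵀ` for a matrix `V` with orthonormal columns, an eigenbasis
for the eigenvalue `1`; the number of columns is the trace and the rank of `E`. -/
theorem exists_orthonormal_columns (hE : Eᵀ = E) (hEE : E * E = E) :
    ∃ (ι : Type) (_ : Fintype ι) (_ : DecidableEq ι) (V : Matrix (Fin n) ι ℝ),
      Vᵀ * V = 1 ∧ V * Vᵀ = E := by
  have hH : E.IsHermitian := isSelfAdjoint_of_transpose_eq hE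
  set U : Matrix (Fin n) (Fin n) ℝ := (hH.eigenvectorUnitary : Matrix (Fin n) (Fin n) ℝ) with hU
  have hUU : Uᵀ * U = 1 := by
    have := Unitary.coe_star_mul_self hH.eigenvectorUnitary
    rwa [Matrix.star_eq_conjTranspose, Matrix.conjTranspose_eq_transpose_of_trivial] at this
  have hspec : E = U * Matrix.diagonal hH.eigenvalues * Uᵀ := by
    have := hH.spectral_theorem
    rw [Unitary.conjStarAlgAut_apply, Matrix.star_eq_conjTranspose,
      Matrix.conjTranspose_eq_transpose_of_trivial] at this
    exact this
  have h01 : ∀ i, hH.eigenvalues i = 0 ∨ hH.eigenvalues i = 1 := fun i => by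
    simpa using IsIdempotentElem.spectrum_subset ℝ (show IsIdempotentElem E from hEE)
      (hH.eigenvalues_mem_spectrum_real i)
  refine ⟨{i // hH.eigenvalues i = 1}, inferInstance, inferInstance,
    U.submatrix id Subtype.val, ?_, ?_⟩
  · rw [Matrix.transpose_submatrix, ← Matrix.submatrix_mul _ _ _ _ _ Function.bijective_id, hUU]
    exact Matrix.submatrix_one _ Subtype.val_injective
  · conv_rhs => rw [hspec]
    ext a b
    rw [Matrix.mul_apply, Matrix.mul_apply]
    simp only [Matrix.mul_diagonal, Matrix.submatrix_apply, Matrix.transpose_apply, id]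
    have hsum := Finset.sum_subtype (F := inferInstance) (p := fun i => hH.eigenvalues i = 1)
      (Finset.univ.filter fun i => hH.eigenvalues i = 1) (by simp) (fun i => U a i * U b i)
    refine hsum.symm.trans ?_
    rw [Finset.sum_filter]
    refine Finset.sum_congr rfl fun i _ => ?_
    rcases h01 i with h | h <;> simp [h]

theorem trace_eq_rank (hE : Eᵀ = E) (hEE : E * E = E) : E.trace = E.rank := by
  obtain ⟨ι, _, _, V, h1, h2⟩ := exists_orthonormal_columns hE hEE
  have hr : E.rank = Fintype.card ι := by
    rw [← h2, Matrix.rank_self_mul_transpose, ← Matrix.rank_transpose_mul_self, h1,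
      Matrix.rank_one]
  rw [hr, ← h2, Matrix.trace_mul_comm, h1, Matrix.trace_one]

/-- Orthogonal projections of equal trace are the initial and the final projection of a partial
isometry. -/
theorem exists_partialIsometry (hE : Eᵀ = E) (hEE : E * E = E) (hF : Fᵀ = F) (hFF : F * F = F)
    (h : E.trace = F.trace) :
    ∃ B : Matrix (Fin n) (Fin n) ℝ, Bᵀ * B = E ∧ B * Bᵀ = F ∧ B * E = B ∧ F * B = B := by
  obtain ⟨ι, _, _, V, h1, h2⟩ := exists_orthonormal_columns hE hEE
  obtain ⟨κ, _, _, W, h3, h4⟩ := exists_orthonormal_columns hF hFF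
  have hcard : Fintype.card ι = Fintype.card κ := by
    rw [← h2, ← h4, Matrix.trace_mul_comm, h1, Matrix.trace_mul_comm, h3, Matrix.trace_one,
      Matrix.trace_one] at h
    exact_mod_cast h
  set W' := W.submatrix id (Fintype.equivOfCardEq hcard)
  have h3' : W'ᵀ * W' = 1 := by
    rw [Matrix.transpose_submatrix, ← Matrix.submatrix_mul _ _ _ _ _ Function.bijective_id, h3,
      Matrix.submatrix_one_equiv]
  have h4' : W' * W'ᵀ = F := by
    rw [Matrix.transpose_submatrix,
      ← Matrix.submatrix_mul _ _ _ _ _ (Equiv.bijective _), h4, Matrix.submatrix_id_id]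
  refine ⟨W' * Vᵀ, ?_, ?_, ?_, ?_⟩
  · rw [Matrix.transpose_mul, Matrix.transpose_transpose, Matrix.mul_assoc,
      ← Matrix.mul_assoc W'ᵀ, h3', Matrix.one_mul, h2]
  · rw [Matrix.transpose_mul, Matrix.transpose_transpose, Matrix.mul_assoc,
      ← Matrix.mul_assoc Vᵀ, h1, Matrix.one_mul, h4']
  · rw [← h2, Matrix.mul_assoc, ← Matrix.mul_assoc Vᵀ, h1, Matrix.one_mul]
  · rw [← h4', Matrix.mul_assoc, ← Matrix.mul_assoc W'ᵀ, h3', Matrix.one_mul]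

end PartialIsometries

/-! ### Surjectivity of the exponential map -/

section Surjectivity

variable {n p : ℕ}

theorem trace_reflection (P : Gr n p) : (reflection P).trace = 2 * p - n := by
  rw [reflection, two_mul, Matrix.trace_sub, Matrix.trace_add, trace_eq_rank P.2.1 P.2.2.1,
    P.2.2.2, Matrix.trace_one, Fintype.card_fin]
  ring

/-- A projection `E` that commutes with `P` and on whose range the reflection of `P` has trace zero
is the square of a symmetric matrix that anticommutes with this reflection: it swaps the two
eigenspaces of the reflection within the range of `E`. -/
theorem exists_anticommuting_sqrt (P : Gr n p) {E : Matrix (Fin n) (Fin n) ℝ} (hE : Eᵀ = E)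
    (hEE : E * E = E) (hPE : P.1 * E = E * P.1) (htr : (reflection P * E).trace = 0) :
    ∃ J : Matrix (Fin n) (Fin n) ℝ,
      Jᵀ = J ∧ J * J = E ∧ reflection P * J = -(J * reflection P) ∧ E * J = J ∧ J * E = J := by
  have hPP := P.2.2.1
  obtain ⟨B, h1, h2, h3, h4⟩ := exists_partialIsometry (E := P.1 * E) (F := (1 - P.1) * E)
    (by rw [Matrix.transpose_mul, hE, P.2.1, hPE])
    (by linear_combination (norm := noncomm_ring) P.1 * P.1 * hEE + hPP * E - P.1 * hPE * E)
    (by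
      rw [Matrix.transpose_mul, hE, Matrix.transpose_sub, P.2.1, Matrix.transpose_one]
      linear_combination (norm := noncomm_ring) hPE)
    (by linear_combination (norm := noncomm_ring)
          hEE - 2 * (P.1 * hEE) + P.1 * P.1 * hEE + hPP * E - P.1 * hPE * E + hPE * E)
    (by
      have h0 : reflection P * E = P.1 * E - (1 - P.1) * E := by
        unfold reflection; noncomm_ring
      rwa [h0, Matrix.trace_sub, sub_eq_zero] at htr)
  have hBP : B * P.1 = B := by
    linear_combination (norm := noncomm_ring) h3 - h3 * P.1 - B * P.1 * hPE + B * hPP * E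
  have hPB : P.1 * B = 0 := by
    linear_combination (norm := noncomm_ring) -(P.1 * h4) - hPP * E * B
  have hEB : E * B = B := by
    linear_combination (norm := noncomm_ring)
      h4 - E * h4 + hEE * B - P.1 * hEE * B + hPE * E * B
  have hBE : B * E = B := by
    linear_combination (norm := noncomm_ring) h3 - h3 * E + B * P.1 * hEE
  have hPBt : P.1 * Bᵀ = Bᵀ := by
    have := congrArg Matrix.transpose hBP
    rwa [Matrix.transpose_mul, P.2.1] at this
  have hBtP : Bᵀ * P.1 = 0 := by
    have := congrArg Matrix.transpose hPB
    rwa [Matrix.transpose_mul, P.2.1, Matrix.transpose_zero] at this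
  have hBtE : Bᵀ * E = Bᵀ := by
    have := congrArg Matrix.transpose hEB
    rwa [Matrix.transpose_mul, hE] at this
  have hEBt : E * Bᵀ = Bᵀ := by
    have := congrArg Matrix.transpose hBE
    rwa [Matrix.transpose_mul, hE] at this
  refine ⟨B + Bᵀ, ?_, ?_, ?_, ?_, ?_⟩
  · rw [Matrix.transpose_add, Matrix.transpose_transpose, add_comm]
  · linear_combination (norm := noncomm_ring)
      h1 + h2 - hBP * B + B * hPB + hBtP * Bᵀ - Bᵀ * hPBt
  · unfold reflection
    linear_combination (norm := noncomm_ring) 2 * hPB + 2 * hBP + 2 * hPBt + 2 * hBtP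
  · rw [mul_add, hEB, hEBt]
  · rw [add_mul, hBE, hBtE]

section Involutions

variable {R : Type*} [Ring R] {S T : R}

theorem involution_commute_anticommutator (hS : S * S = 1) :
    S * (T * S + S * T) = (T * S + S * T) * S := by
  linear_combination (norm := noncomm_ring) hS * T - T * hS

theorem involution_commute_anticommutator' (hT : T * T = 1) :
    T * (T * S + S * T) = (T * S + S * T) * T := by
  linear_combination (norm := noncomm_ring) hT * S - S * hT

theorem add_mul_self_of_involution (hS : S * S = 1) (hT : T * T = 1) :
    (T + S) * (T + S) = 2 + (T * S + S * T) := by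
  rw [← one_add_one_eq_two]
  linear_combination (norm := noncomm_ring) hS + hT

theorem involution_anticommute_sub (hS : S * S = 1) :
    S * (T - S * T * S) = -((T - S * T * S) * S) := by
  linear_combination (norm := noncomm_ring) -(hS * T * S) - S * T * hS

theorem sub_mul_self_of_involution (hS : S * S = 1) (hT : T * T = 1) :
    (T - S * T * S) * (T - S * T * S) = 4 - (T * S + S * T) * (T * S + S * T) := by
  rw [show (4 : R) = 1 + 1 + 1 + 1 by norm_num]
  linear_combination (norm := noncomm_ring)
    hT + S * T * hS * T * S + S * hT * S + hS + T * hS * T + hT + S * hT * S + hS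

end Involutions

/-- On the eigenspace `-1` of the product of the two reflections they are opposite to each other,
and on its complement they are conjugate by their sum. As their traces are equal, both have trace
zero on that eigenspace. -/
theorem trace_reflection_mul_eq_zero (P Q : Gr n p) {E k : Matrix (Fin n) (Fin n) ℝ}
    (hE : (reflection Q + reflection P) * E = 0)
    (hk : reflection P * k = k * reflection P) (hk' : reflection Q * k = k * reflection Q)
    (h : (reflection Q + reflection P) * (reflection Q + reflection P) * k = 1 - E) :
    (reflection P * E).trace = 0 := by
  have hS := reflection_mul_self P
  have hT := reflection_mul_self Q
  have htr : (reflection P).trace = (reflection Q).trace := by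
    rw [trace_reflection, trace_reflection]
  generalize reflection P = S at *
  generalize reflection Q = T at *
  have h1 : S * (1 - E) = (T + S) * (T * (T + S) * k) := by
    rw [← h]
    linear_combination (norm := noncomm_ring) hS * (T + S) * k - hT * (T + S) * k
  have h2 : T * (1 - E) = (T * (T + S) * k) * (T + S) := by
    rw [← h]
    linear_combination (norm := noncomm_ring) T * (T + S) * (hk + hk')
  have h3 : (S * (1 - E)).trace = (T * (1 - E)).trace := by
    rw [h1, h2, Matrix.trace_mul_comm]
  have h4 : T * E = -(S * E) := by
    linear_combination (norm := noncomm_ring) hE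
  rw [mul_sub, mul_sub, mul_one, mul_one, Matrix.trace_sub, Matrix.trace_sub, h4,
    Matrix.trace_neg] at h3
  linarith

theorem cfc_ofNat {X : Matrix (Fin n) (Fin n) ℝ} (hX : Xᵀ = X) (k : ℕ) [k.AtLeastTwo] :
    cfc (fun _ : ℝ => (OfNat.ofNat k : ℝ)) X = OfNat.ofNat k := by
  rw [cfc_const _ X (isSelfAdjoint_of_transpose_eq hX), map_ofNat]

/-- A square `Z ^ 2 = 2 + X` of a symmetric matrix forces the spectrum of `X` to be at least
`-2`. -/
theorem neg_two_le_of_mem_spectrum {X Z : Matrix (Fin n) (Fin n) ℝ} (hX : Xᵀ = X) (hZ : Zᵀ = Z)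
    (h : Z * Z = 2 + X) {x : ℝ} (hx : x ∈ spectrum ℝ X) : -2 ≤ x := by
  have h1 : (Zᴴ * Z).PosSemidef := Matrix.posSemidef_conjTranspose_mul_self Z
  rw [Matrix.conjTranspose_eq_transpose_of_trivial, hZ, h] at h1
  have h2 := (Matrix.posSemidef_iff_isHermitian_and_spectrum_nonneg.1 h1).2
  have h3 : cfc (fun x : ℝ => 2 + x) X = 2 + X := by
    rw [cfc_add_matrix (fun _ => 2) (fun x => x), cfc_eq_self hX, cfc_ofNat hX 2]
  have h4 : 2 + x ∈ spectrum ℝ (2 + X) := by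
    rw [← h3, spectrum_cfc _ hX]
    exact ⟨x, hx, rfl⟩
  have := h2 h4
  simp only [Set.mem_ofPred_eq] at this
  linarith

/-- The sine `w` of a velocity `v` from `P` to `Q`. With `S`, `T` the reflections of `P`, `Q`, such
a velocity has `T = cos (2 v) S + sin (2 v)`, so `X = T S + S T` has to be `2 cos (2 v)` and
`T - S T S` has to be `2 sin (2 v)`. Off the eigenspace `-2` of `X` the matrix `w` is determined by
these; on it, where the principal angles are `π / 2`, any anticommuting square root will do. -/
theorem exists_sin_velocity (P Q : Gr n p) :
    ∃ w X : Matrix (Fin n) (Fin n) ℝ,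
      X = reflection Q * reflection P + reflection P * reflection Q ∧ Xᵀ = X ∧
      (∀ x ∈ spectrum ℝ X, -2 ≤ x) ∧ wᵀ = w ∧
      reflection P * w = -(w * reflection P) ∧
      w * w = cfc (fun x : ℝ => (2 - x) / 4) X ∧
      4 * (w * cfc (fun x => √(2 + x) / 2) X) =
        reflection Q - reflection P * reflection Q * reflection P := by
  have hS := reflection_mul_self P
  have hT := reflection_mul_self Q
  have hSt := transpose_reflection P
  have hTt := transpose_reflection Q
  set S := reflection P with hSdef
  set T := reflection Q with hTdef
  set X := T * S + S * T with hXdef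
  have hX : Xᵀ = X := by
    simp only [hXdef, Matrix.transpose_add, Matrix.transpose_mul, hSt, hTt, add_comm]
  have hSX : S * X = X * S := involution_commute_anticommutator hS
  have hTX : T * X = X * T := involution_commute_anticommutator' hT
  have hZ : (T + S) * (T + S) = 2 + X := add_mul_self_of_involution hS hT
  have hZt : (T + S)ᵀ = T + S := by rw [Matrix.transpose_add, hSt, hTt]
  have hspec : ∀ x ∈ spectrum ℝ X, -2 ≤ x := fun x hx =>
    neg_two_le_of_mem_spectrum hX hZt hZ hx
  have h2X : cfc (fun x : ℝ => 2 + x) X = 2 + X := by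
    rw [cfc_add_matrix (fun _ => 2) (fun x => x), cfc_eq_self hX, cfc_ofNat hX 2]
  -- the projection onto the eigenspace where both reflections are opposite to each other
  set e : ℝ → ℝ := fun x => if x = -2 then 1 else 0 with he
  set E := cfc e X with hEdef
  have hE : Eᵀ = E := transpose_cfc e X
  have hEE : E * E = E := by
    rw [hEdef, ← cfc_mul_matrix]
    congr 1; funext x; simp [he]
  have hSE : S * E = E * S := mul_cfc_of_commute hX hSX e
  have hTE : T * E = E * T := mul_cfc_of_commute hX hTX e
  have hZE : (T + S) * E = 0 := by
    have h1 : ((T + S) * E)ᵀ * ((T + S) * E) = 0 := by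
      calc ((T + S) * E)ᵀ * ((T + S) * E) = E * ((T + S) * (T + S) * E) := by
            rw [Matrix.transpose_mul, hE, hZt]; simp only [mul_assoc]
        _ = 0 := by
            rw [hZ, ← h2X, hEdef, ← cfc_mul_matrix]
            have : (fun x => (2 + x) * e x) = fun _ => (0 : ℝ) := by
              funext x; simp only [he]; split_ifs with h <;> simp [h]
            rw [this, cfc_const_zero, mul_zero]
    rwa [← Matrix.conjTranspose_eq_transpose_of_trivial,
      Matrix.conjTranspose_mul_self_eq_zero] at h1
  have hone : cfc (fun x => 1 - e x) X = 1 - E := by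
    rw [cfc_sub_matrix (fun _ => 1) e,
      cfc_const_one ℝ X (isSelfAdjoint_of_transpose_eq hX)]
  have htr : (S * E).trace = 0 := by
    refine trace_reflection_mul_eq_zero P Q (k := cfc (fun x => (2 + x)⁻¹) X) hZE
      (mul_cfc_of_commute hX hSX _) (mul_cfc_of_commute hX hTX _) ?_
    rw [← hSdef, ← hTdef, hZ, ← h2X, ← cfc_mul_matrix, ← hone]
    congr 1; funext x
    simp only [he]
    split_ifs with h
    · simp [h]
    · rw [sub_zero, mul_inv_cancel₀]
      intro h'; exact h (by linarith)
  have hPE : P.1 * E = E * P.1 := by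
    have h2 : (2 : ℝ) • (P.1 * E) = (2 : ℝ) • (E * P.1) := by
      rw [two_smul, two_smul]
      rw [hSdef, reflection] at hSE
      linear_combination (norm := noncomm_ring) hSE
    exact smul_right_injective _ (two_ne_zero' ℝ) h2
  obtain ⟨J, hJ, hJJ, hSJ, hEJ, hJE⟩ := exists_anticommuting_sqrt P hE hEE hPE htr
  rw [← hSdef] at hSJ
  set Y := T - S * T * S with hYdef
  have hY : Yᵀ = Y := by
    simp only [hYdef, Matrix.transpose_sub, Matrix.transpose_mul, hSt, hTt, mul_assoc]
  have hSY : S * Y = -(Y * S) := involution_anticommute_sub hS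
  have hYX : Y * X = X * Y := by
    rw [hYdef]
    linear_combination (norm := noncomm_ring)
      hTX - hSX * T * S - S * hTX * S - S * T * hSX
  have hYY : Y * Y = 4 - X * X := sub_mul_self_of_involution hS hT
  have hYE : Y * E = 0 := by
    rw [hYdef]
    linear_combination (norm := noncomm_ring)
      hZE - S * T * hSE - S * hZE * S + hS * E * S - hSE
  -- `g` vanishes at `-2` because of the convention `0⁻¹ = 0`
  set g : ℝ → ℝ := fun x => (2 * √(2 + x))⁻¹ with hg
  have hYg : Y * cfc g X = cfc g X * Y := mul_cfc_of_commute hX hYX g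
  have hSg : S * cfc g X = cfc g X * S := mul_cfc_of_commute hX hSX g
  have hmulE : ∀ f : ℝ → ℝ, f (-2) = 0 → E * cfc f X = 0 := by
    intro f hf
    rw [hEdef, ← cfc_mul_matrix]
    have : (fun x => e x * f x) = fun _ => (0 : ℝ) := by
      funext x; simp only [he]; split_ifs with h <;> simp [h, hf]
    rw [this, cfc_const_zero]
  have hEg : E * cfc g X = 0 := hmulE g (by simp [hg])
  have hgE : cfc g X * E = 0 := by
    rw [← hEg, hEdef, ← cfc_mul_matrix, ← cfc_mul_matrix]
    simp only [mul_comm]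
  have hJg : J * cfc g X = 0 := by rw [← hJE, mul_assoc, hEg, mul_zero]
  have hgJ : cfc g X * J = 0 := by rw [← hEJ, ← mul_assoc, hgE, zero_mul]
  refine ⟨Y * cfc g X + J, X, rfl, hX, hspec, ?_, ?_, ?_, ?_⟩
  · rw [Matrix.transpose_add, Matrix.transpose_mul, hJ, hY, transpose_cfc, hYg]
  · linear_combination (norm := noncomm_ring) hSY * cfc g X - Y * hSg + hSJ
  · have h1 : (Y * cfc g X + J) * (Y * cfc g X + J) =
        (4 - X * X) * (cfc g X * cfc g X) + E := by
      rw [← hYY, ← hJJ]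
      linear_combination (norm := noncomm_ring)
        -(Y * hYg * cfc g X) + Y * hgJ + J * hYg + hJg * Y
    have h4X : cfc (fun x : ℝ => 4 - x * x) X = 4 - X * X := by
      rw [cfc_sub_matrix (fun _ => 4) (fun x => x * x), cfc_mul_matrix, cfc_eq_self hX,
        cfc_ofNat hX 4]
    rw [h1, ← h4X, hEdef, ← cfc_mul_matrix, ← cfc_mul_matrix, ← cfc_add_matrix]
    refine cfc_congr fun x hx => ?_
    simp only [he, hg]
    split_ifs with h
    · subst h; norm_num
    · have hx2 : 0 < 2 + x := lt_of_le_of_ne (by linarith [hspec x hx]) fun h' => h (by linarith)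
      rw [← mul_inv, mul_mul_mul_comm, Real.mul_self_sqrt hx2.le]
      field_simp
      ring
  · have h1 : J * cfc (fun x => √(2 + x) / 2) X = 0 := by
      rw [← hJE, mul_assoc, hmulE _ (by simp), mul_zero]
    have h2 : 4 * (cfc g X * cfc (fun x => √(2 + x) / 2) X) = 1 - E := by
      have h4 : (4 : Matrix (Fin n) (Fin n) ℝ) = cfc (fun _ : ℝ => (4 : ℝ)) X :=
        (cfc_ofNat hX 4).symm
      rw [h4, ← hone, ← cfc_mul_matrix, ← cfc_mul_matrix]
      refine cfc_congr fun x hx => ?_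
      simp only [he, hg]
      split_ifs with h
      · subst h; simp
      · have hx2 : 0 < 2 + x :=
          lt_of_le_of_ne (by linarith [hspec x hx]) fun h' => h (by linarith)
        have := Real.sqrt_pos.2 hx2
        field_simp
        norm_num
    linear_combination (norm := noncomm_ring) Y * h2 + 4 * h1 - hYE

end Surjectivity

/-! ### Existence of minimizing geodesics -/

section Logarithm

variable {n p : ℕ}

theorem expMap_surjective (P Q : Gr n p) : ∃ v ∈ tangentSpace P, expMap P v = Q := by
  obtain ⟨w, X, hXdef, hX, hspec, hw, hSw, hww, hwX⟩ := exists_sin_velocity P Q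
  have hS := reflection_mul_self P
  have hwT : w ∈ tangentSpace P := mem_tangentSpace_iff.2 ⟨hw, hSw⟩
  have hvT : cfc Real.arcsin w ∈ tangentSpace P := cfc_mem_tangentSpace hwT Real.arcsin_neg
  have hrange : ∀ x ∈ spectrum ℝ w, x * x ≤ 1 := by
    intro x hx
    have h1 : x * x ∈ spectrum ℝ (w * w) := by
      rw [← cfc_eq_self hw, ← cfc_mul_matrix, spectrum_cfc _ hw]
      exact ⟨x, hx, rfl⟩
    rw [hww, spectrum_cfc _ hX] at h1
    obtain ⟨y, hy, hyx⟩ := h1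
    have := hspec y hy
    simp only at hyx
    linarith
  have hcos : cfc (fun x => Real.cos (2 * x)) (cfc Real.arcsin w) = 1 - 2 * (w * w) := by
    have h1 : cfc (fun x : ℝ => 1 - 2 * (x * x)) w = 1 - 2 * (w * w) := by
      rw [cfc_sub_matrix (fun _ => 1) (fun x => 2 * (x * x)),
        cfc_const_one ℝ w (isSelfAdjoint_of_transpose_eq hw), cfc_mul_matrix (fun _ => 2),
        cfc_mul_matrix, cfc_eq_self hw, cfc_ofNat hw 2]
    rw [← h1, ← cfc_comp_matrix _ _ hw]
    refine cfc_congr fun x hx => ?_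
    have := abs_le_one_iff_mul_self_le_one.2 (hrange x hx)
    simp only [Real.cos_two_mul_eq_one_sub]
    rw [Real.sin_arcsin (abs_le.1 this).1 (abs_le.1 this).2, pow_two]
  have hsin : cfc (fun x => Real.sin (2 * x)) (cfc Real.arcsin w) =
      2 * (w * cfc (fun x => √(2 + x) / 2) X) := by
    have h1 : cfc (fun x => √(2 + x) / 2) X = cfc (fun x => √(1 - x * x)) w := by
      rw [cfc_comp_matrix (fun y => √(1 - y)) (fun x => x * x) hw, cfc_mul_matrix, cfc_eq_self hw,
        hww, ← cfc_comp_matrix _ _ hX]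
      congr 1
      funext x
      rw [show 1 - (2 - x) / 4 = (2 + x) / 2 ^ 2 by ring, Real.sqrt_div' _ (by positivity),
        Real.sqrt_sq (by norm_num)]
    have h2 : cfc (fun x : ℝ => 2 * (x * √(1 - x * x))) w =
        2 * (w * cfc (fun x => √(1 - x * x)) w) := by
      rw [cfc_mul_matrix (fun _ => 2) (fun x => x * √(1 - x * x)),
        cfc_mul_matrix (fun x => x), cfc_eq_self hw, cfc_ofNat hw 2]
    rw [h1, ← h2, ← cfc_comp_matrix _ _ hw]
    refine cfc_congr fun x hx => ?_
    have := abs_le_one_iff_mul_self_le_one.2 (hrange x hx)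
    simp only [Real.sin_two_mul]
    rw [Real.sin_arcsin (abs_le.1 this).1 (abs_le.1 this).2, Real.cos_arcsin, pow_two, mul_assoc]
  have h4 : 4 * (w * w) = 2 - X := by
    have h5 : cfc (fun x : ℝ => 4 * ((2 - x) / 4)) X = 2 - X := by
      have : (fun x : ℝ => 4 * ((2 - x) / 4)) = fun x => 2 - x := by funext x; ring
      rw [this, cfc_sub_matrix (fun _ => 2) (fun x => x), cfc_eq_self hX, cfc_ofNat hX 2]
    rw [← h5, cfc_mul_matrix (fun _ => 4), ← hww, cfc_ofNat hX 4]
  refine ⟨_, hvT, reflection_injective ?_⟩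
  rw [reflection_expMap hvT, hcos, hsin]
  refine smul_right_injective _ (two_ne_zero' ℝ) ?_
  simp only [two_smul]
  linear_combination (norm := noncomm_ring)
    -(h4 * reflection P) + hwX + hXdef * reflection P + reflection Q * hS

open scoped Matrix.Norms.Operator in
theorem continuous_rotation (P : Gr n p) : Continuous (rotation P) := by
  unfold rotation
  exact NormedSpace.exp_continuous.comp (by fun_prop)

theorem metric_self_eq_sum (v : Matrix (Fin n) (Fin n) ℝ) :
    metric v v = 1 / 2 * ∑ j, ∑ i, v i j ^ 2 := by
  simp [metric, Matrix.trace, Matrix.mul_apply, pow_two]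

/-- Every point is the endpoint of a minimizing geodesic, by compactness of the set of velocities
of bounded length that lead to it. -/
theorem exists_isMinimizing (P Q : Gr n p) : ∃ v, IsMinimizing P v ∧ expMap P v = Q := by
  obtain ⟨v₀, hv₀, hQ⟩ := expMap_surjective P Q
  set K : Set (Matrix (Fin n) (Fin n) ℝ) :=
    {v | (vᵀ = v ∧ P.1 * v + v * P.1 = v) ∧ rotation P v * P.1 * (rotation P v)ᵀ = Q.1 ∧
      metric v v ≤ metric v₀ v₀} with hK
  have hmem : ∀ v, v ∈ K ↔ v ∈ tangentSpace P ∧ expMap P v = Q ∧ metric v v ≤ metric v₀ v₀ := by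
    intro v
    refine and_congr_right fun hv => and_congr_left fun _ => ?_
    rw [← expMap_coe hv]
    exact Subtype.ext_iff.symm
  have hcont : Continuous fun v : Matrix (Fin n) (Fin n) ℝ => metric v v := by
    unfold metric
    fun_prop
  have hrot := continuous_rotation P
  have hclosed : IsClosed K := by
    refine IsClosed.and (IsClosed.and ?_ ?_) (IsClosed.and ?_ ?_)
    · exact isClosed_eq (by fun_prop) (by fun_prop)
    · exact isClosed_eq (by fun_prop) (by fun_prop)
    · exact isClosed_eq (by fun_prop) (by fun_prop)
    · exact isClosed_le hcont continuous_const
  set M := √(2 * metric v₀ v₀) with hM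
  have hbox : IsCompact
      (Set.univ.pi fun _ : Fin n => Set.univ.pi fun _ : Fin n => Set.Icc (-M) M) :=
    isCompact_univ_pi fun _ => isCompact_univ_pi fun _ => isCompact_Icc
  have hcompact : IsCompact K := by
    refine IsCompact.of_isClosed_subset hbox hclosed fun v hv i _ j _ => ?_
    rw [Set.mem_Icc, ← abs_le]
    apply Real.abs_le_sqrt
    have h1 := hv.2.2
    rw [metric_self_eq_sum v] at h1
    have h2 : v i j ^ 2 ≤ ∑ i, v i j ^ 2 :=
      Finset.single_le_sum (f := fun i => v i j ^ 2) (fun _ _ => sq_nonneg _) (Finset.mem_univ i)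
    have h3 : ∑ i, v i j ^ 2 ≤ ∑ j, ∑ i, v i j ^ 2 :=
      Finset.single_le_sum (f := fun j => ∑ i, v i j ^ 2)
        (fun _ _ => Finset.sum_nonneg fun _ _ => sq_nonneg _) (Finset.mem_univ j)
    linarith
  obtain ⟨v, hvK, hvmin⟩ := hcompact.exists_isMinOn ⟨v₀, (hmem v₀).2 ⟨hv₀, hQ, le_rfl⟩⟩
    hcont.continuousOn
  obtain ⟨hv1, hv2, hv3⟩ := (hmem v).1 hvK
  refine ⟨v, ⟨hv1, fun w hw hwv => ?_⟩, hv2⟩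
  rcases le_total (metric w w) (metric v₀ v₀) with h | h
  · exact hvmin ((hmem w).2 ⟨hw, hwv.trans hv2, h⟩)
  · exact hv3.trans h

theorem isMinimizing_logMap (P Q : Gr n p) : IsMinimizing P (logMap P Q) := by
  rw [logMap, dif_pos (exists_isMinimizing P Q)]
  exact (exists_isMinimizing P Q).choose_spec.1

theorem expMap_logMap (P Q : Gr n p) : expMap P (logMap P Q) = Q := by
  rw [logMap, dif_pos (exists_isMinimizing P Q)]
  exact (exists_isMinimizing P Q).choose_spec.2

end Logarithm

/-! ### Isometries of the Grassmannian -/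

section Isometries

variable {n p : ℕ} {K L : Matrix (Fin n) (Fin n) ℝ} {P Q : Gr n p} {v : Matrix (Fin n) (Fin n) ℝ}

theorem transpose_orthogonal (hK : Kᵀ * K = 1) : Kᵀᵀ * Kᵀ = 1 := by
  rw [Matrix.transpose_transpose, mul_eq_one_comm.1 hK]

theorem mul_orthogonal (hK : Kᵀ * K = 1) (hL : Lᵀ * L = 1) : (K * L)ᵀ * (K * L) = 1 := by
  rw [Matrix.transpose_mul, mul_assoc, ← mul_assoc Kᵀ, hK, one_mul, hL]

theorem conj_conj (hK : Kᵀ * K = 1) (hL : Lᵀ * L = 1) (P : Gr n p) :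
    conj K hK (conj L hL P) = conj (K * L) (mul_orthogonal hK hL) P := by
  apply Subtype.ext
  simp only [conj, Matrix.transpose_mul, mul_assoc]

theorem conj_transpose_conj (hK : Kᵀ * K = 1) (P : Gr n p) :
    conj Kᵀ (transpose_orthogonal hK) (conj K hK P) = P := by
  rw [conj_conj]
  apply Subtype.ext
  simp only [conj, hK]
  simp

theorem transpose_mul_conj_mul (hK : Kᵀ * K = 1) (v : Matrix (Fin n) (Fin n) ℝ) :
    Kᵀ * (K * v * Kᵀ) * Kᵀᵀ = v := by
  calc Kᵀ * (K * v * Kᵀ) * Kᵀᵀ = (Kᵀ * K) * v * (Kᵀ * K) := by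
        rw [Matrix.transpose_transpose]; simp only [mul_assoc]
    _ = v := by rw [hK, one_mul, mul_one]

theorem rotation_conj (hK : Kᵀ * K = 1) (P : Gr n p) (v : Matrix (Fin n) (Fin n) ℝ) :
    rotation (conj K hK P) (K * v * Kᵀ) = K * rotation P v * Kᵀ := by
  have hinv : K⁻¹ = Kᵀ := Matrix.inv_eq_left_inv hK
  rw [rotation, rotation, ← hinv, ← Matrix.exp_conj _ _ (IsUnit.of_mul_eq_one_right _ hK), hinv]
  congr 1
  simp only [conj]
  linear_combination (norm := noncomm_ring) K * v * hK * P.1 * Kᵀ - K * P.1 * hK * v * Kᵀ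

theorem expMap_conj (hK : Kᵀ * K = 1) (hv : v ∈ tangentSpace P) :
    expMap (conj K hK P) (K * v * Kᵀ) = conj K hK (expMap P v) := by
  apply Subtype.ext
  rw [expMap_coe (mem_tangentSpace_conj hK hv), rotation_conj]
  simp only [conj]
  rw [expMap_coe hv]
  simp only [Matrix.transpose_mul, Matrix.transpose_transpose]
  linear_combination (norm := noncomm_ring)
    K * rotation P v * hK * P.1 * Kᵀ * K * (rotation P v)ᵀ * Kᵀ +
      K * rotation P v * P.1 * hK * (rotation P v)ᵀ * Kᵀ

theorem metric_conj (hK : Kᵀ * K = 1) (v : Matrix (Fin n) (Fin n) ℝ) :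
    metric (K * v * Kᵀ) (K * v * Kᵀ) = metric v v := by
  have h : (K * v * Kᵀ)ᵀ * (K * v * Kᵀ) = K * (vᵀ * v * Kᵀ) := by
    simp only [Matrix.transpose_mul, Matrix.transpose_transpose]
    linear_combination (norm := noncomm_ring) K * vᵀ * hK * v * Kᵀ
  rw [metric, metric, h, Matrix.trace_mul_comm, mul_assoc, hK, mul_one]

theorem IsMinimizing.conj (hK : Kᵀ * K = 1) (hv : IsMinimizing P v) :
    IsMinimizing (conj K hK P) (K * v * Kᵀ) := by
  refine ⟨mem_tangentSpace_conj hK hv.1, fun w hw h => ?_⟩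
  have hw' := mem_tangentSpace_conj (transpose_orthogonal hK) hw
  have hend := expMap_conj (transpose_orthogonal hK) hw
  rw [conj_transpose_conj] at hw' hend
  rw [h, expMap_conj hK hv.1, conj_transpose_conj] at hend
  have := hv.2 _ hw' hend
  rwa [metric_conj (transpose_orthogonal hK), ← metric_conj hK] at this

theorem conj_mem_cutLocus (hK : Kᵀ * K = 1) (h : Q ∈ cutLocus P) :
    conj K hK Q ∈ cutLocus (conj K hK P) := by
  obtain ⟨v, hv, rfl, hcut⟩ := h
  refine ⟨K * v * Kᵀ, hv.conj hK, expMap_conj hK hv.1, fun s hs hmin => hcut s hs ?_⟩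
  have := hmin.conj (transpose_orthogonal hK)
  rwa [← smul_mul_assoc, ← mul_smul_comm, conj_transpose_conj, transpose_mul_conj_mul hK] at this

theorem conj_mem_cutLocus_iff (hK : Kᵀ * K = 1) :
    conj K hK Q ∈ cutLocus (conj K hK P) ↔ Q ∈ cutLocus P := by
  refine ⟨fun h => ?_, conj_mem_cutLocus hK⟩
  have := conj_mem_cutLocus (transpose_orthogonal hK) h
  rwa [conj_transpose_conj, conj_transpose_conj] at this

/-- Isometries preserve the length of a minimizing geodesic. -/
theorem metric_logMap_conj (hK : Kᵀ * K = 1) (P Q : Gr n p) :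
    metric (logMap (conj K hK P) (conj K hK Q)) (logMap (conj K hK P) (conj K hK Q)) =
      metric (logMap P Q) (logMap P Q) := by
  have h1 := (isMinimizing_logMap P Q).conj hK
  have h2 := isMinimizing_logMap (conj K hK P) (conj K hK Q)
  have hend : expMap (conj K hK P) (K * logMap P Q * Kᵀ) =
      expMap (conj K hK P) (logMap (conj K hK P) (conj K hK Q)) := by
    rw [expMap_conj hK (isMinimizing_logMap P Q).1, expMap_logMap, expMap_logMap]
  rw [← metric_conj hK (logMap P Q)]
  exact le_antisymm (h2.2 _ h1.1 hend) (h1.2 _ h2.1 hend.symm)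

end Isometries

/-! ### Gyroaddition -/

section Gyroaddition

variable {n p : ℕ} {hp : p ≤ n} {K : Matrix (Fin n) (Fin n) ℝ} {P : Gr n p}

theorem transpose_mul_rotation_logMap (P Q : Gr n p) :
    (rotation P (logMap P Q))ᵀ * rotation P (logMap P Q) = 1 :=
  transpose_mul_rotation (isMinimizing_logMap P Q).1

theorem conj_rotation_logMap (P Q : Gr n p) :
    conj (rotation P (logMap P Q)) (transpose_mul_rotation_logMap P Q) P = Q := by
  apply Subtype.ext
  simp only [conj]
  rw [← expMap_coe (isMinimizing_logMap P Q).1, expMap_logMap]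

/-- Left gyrotranslation by `A` is the isometry given by the rotation along the minimizing geodesic
from the identity element to `A`. -/
theorem gyroAdd_eq_conj (hp : p ≤ n) (A Q : Gr n p) :
    gyroAdd hp A Q = conj (rotation (idPoint hp) (logMap (idPoint hp) A))
      (transpose_mul_rotation_logMap _ A) Q := by
  have hA := isMinimizing_logMap (idPoint hp) A
  have hQ := isMinimizing_logMap (idPoint hp) Q
  have h := expMap_conj (transpose_mul_rotation_logMap (idPoint hp) A) hQ.1
  rw [conj_rotation_logMap, expMap_logMap] at h
  rw [gyroAdd, transport_eq hA.1 hQ.1, h]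

theorem gyroNorm_conj (hK : Kᵀ * K = 1) (h : conj K hK (idPoint hp) = idPoint hp) (R : Gr n p) :
    gyroNorm hp (conj K hK R) = gyroNorm hp R := by
  have := metric_logMap_conj hK (idPoint hp) R
  rw [h] at this
  rw [gyroNorm, gyroNorm, gyroInner, gyroInner, this]

/-- The geodesic reflection at the identity element sends a minimizing velocity to its negative. If
`P` is not in the cut locus, this forces the logarithm of `Exp (-Log P)` to be `-Log P`. -/
theorem exists_left_inverse (hP : P ∉ cutLocus (idPoint hp)) :
    ∃ X : Gr n p, gyroAdd hp X P = idPoint hp := by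
  set I := idPoint hp with hI
  set S := reflection I with hSdef
  have hS : Sᵀ * S = 1 := by rw [transpose_reflection, reflection_mul_self]
  have hSI : conj S hS I = I := by
    apply Subtype.ext
    simp only [conj]
    rw [transpose_reflection, hSdef, reflection]
    linear_combination (norm := noncomm_ring) 4 * I.2.2.1 * I.1
  have hneg : ∀ w ∈ tangentSpace I, S * w * Sᵀ = -w := by
    intro w hw
    rw [transpose_reflection, (mem_tangentSpace_iff.1 hw).2, neg_mul, mul_assoc,
      reflection_mul_self, mul_one]
  have hmin : ∀ w, IsMinimizing I w → IsMinimizing I (-w) := by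
    intro w hw
    have := hw.conj hS
    rwa [hSI, hneg w hw.1] at this
  have hexp : ∀ w ∈ tangentSpace I, expMap I (-w) = conj S hS (expMap I w) := by
    intro w hw
    have := expMap_conj hS hw
    rwa [hSI, hneg w hw] at this
  have hv := isMinimizing_logMap I P
  set X := expMap I (-logMap I P) with hX
  have hu := isMinimizing_logMap I X
  have hend : expMap I (-logMap I X) = expMap I (logMap I P) := by
    rw [hexp _ hu.1, expMap_logMap, hX, ← hexp _ (Submodule.neg_mem _ hv.1), neg_neg]
  have huv := isMinimizing_unique (hmin _ hu) hv hend (by rwa [expMap_logMap])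
  refine ⟨X, ?_⟩
  have hrot : rotation I (logMap I X) = (rotation I (logMap I P))ᵀ := by
    rw [← rotation_neg hv.1, ← huv, neg_neg]
  rw [gyroAdd_eq_conj]
  apply Subtype.ext
  simp only [conj]
  have hR := transpose_mul_rotation_logMap I P
  have hPcoe : P.1 = rotation I (logMap I P) * I.1 * (rotation I (logMap I P))ᵀ := by
    rw [← expMap_coe hv.1, expMap_logMap]
  rw [← hI, hrot]
  conv_lhs => rw [hPcoe]
  exact transpose_mul_conj_mul hR I.1

theorem gyroNeg_gyroAdd (hP : P ∉ cutLocus (idPoint hp)) :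
    gyroAdd hp (gyroNeg hp P) P = idPoint hp := by
  rw [gyroNeg, dif_pos (exists_left_inverse hP)]
  exact (exists_left_inverse hP).choose_spec

/-- If `x` and `y a` both send `P` to the identity element, then they differ by the isometry
`y a xᵀ`, which fixes the identity element, so the norm and the cut locus do not distinguish the
images of any point `Q` under the two. -/
theorem cutLocus_and_gyroNorm_conj_eq {a x y : Matrix (Fin n) (Fin n) ℝ} (ha : aᵀ * a = 1)
    (hx : xᵀ * x = 1) (hy : yᵀ * y = 1) (hxP : conj x hx P = idPoint hp)
    (hyP : conj y hy (conj a ha P) = idPoint hp) (Q : Gr n p) :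
    (conj y hy (conj a ha Q) ∈ cutLocus (idPoint hp) ↔ conj x hx Q ∈ cutLocus (idPoint hp)) ∧
      gyroNorm hp (conj y hy (conj a ha Q)) = gyroNorm hp (conj x hx Q) := by
  have hK : (y * a * xᵀ)ᵀ * (y * a * xᵀ) = 1 :=
    mul_orthogonal (mul_orthogonal hy ha) (transpose_orthogonal hx)
  have hrel : ∀ R : Gr n p, conj y hy (conj a ha R) = conj (y * a * xᵀ) hK (conj x hx R) := by
    intro R
    rw [← conj_conj (mul_orthogonal hy ha) (transpose_orthogonal hx), conj_transpose_conj,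
      conj_conj]
  have hfix : conj (y * a * xᵀ) hK (idPoint hp) = idPoint hp := by
    rw [← hxP, ← hrel P, hyP, hxP]
  rw [hrel Q]
  refine ⟨?_, gyroNorm_conj hK hfix _⟩
  conv_lhs => rw [← hfix]
  exact conj_mem_cutLocus_iff hK

end Gyroaddition

end GrassmannGyro

theorem mainTheorem6 (n p : ℕ) (hp : p ≤ n) (A P Q : GrassmannGyro.Gr n p)
    (hA : A ∉ GrassmannGyro.cutLocus (GrassmannGyro.idPoint hp))
    (hP : P ∉ GrassmannGyro.cutLocus (GrassmannGyro.idPoint hp))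
    (hAP : GrassmannGyro.leftGyrotranslation hp A P ∉
      GrassmannGyro.cutLocus (GrassmannGyro.idPoint hp)) :
    (GrassmannGyro.gyroAdd hp
        (GrassmannGyro.gyroNeg hp (GrassmannGyro.leftGyrotranslation hp A P))
        (GrassmannGyro.leftGyrotranslation hp A Q) ∈
          GrassmannGyro.cutLocus (GrassmannGyro.idPoint hp) ↔
      GrassmannGyro.gyroAdd hp (GrassmannGyro.gyroNeg hp P) Q ∈
          GrassmannGyro.cutLocus (GrassmannGyro.idPoint hp)) ∧
    GrassmannGyro.gyroDist hp (GrassmannGyro.leftGyrotranslation hp A P)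
        (GrassmannGyro.leftGyrotranslation hp A Q) =
      GrassmannGyro.gyroDist hp P Q := by
  have hX := GrassmannGyro.gyroNeg_gyroAdd hP
  have hY := GrassmannGyro.gyroNeg_gyroAdd hAP
  simp only [GrassmannGyro.gyroDist, GrassmannGyro.leftGyrotranslation,
    GrassmannGyro.gyroAdd_eq_conj] at hX hY ⊢
  exact GrassmannGyro.cutLocus_and_gyroNorm_conj_eq _ _ _ hX hY Q
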